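/- Let $M$ be a compact connected smooth Riemannian manifold (without boundary) of dimension $d$, with Riemannian distance and normalized Lebesgue (Riemannian volume) measure $\lambda$. Let $g_1,\dots,g_N:M\to M$ be local diffeomorphisms (possibly diffeomorphisms) of class $C^{1+\alpha}$, $0<\alpha\le 1$, that are conformal, i.e. each $Dg_i(x)$ is a scalar multiple of a linear isometry $T_xM\to T_{g_i(x)}M$. Let $\Gamma$ be the semigroup of all finite compositions of the $g_i$, including the identity; write $|h|=n$ if $h$ is a composition of $n$ of the $g_i$. Assume that $\Gamma$ is *locally expanding*: for every $x\in M$ there is $h\in\Gamma$ with $\|Dh(x)^{-1}\|^{-1}>1$. Assume that $\Gamma$ is *topologically mixing*, in the following sense. There are $f_1,\dots,f_k\in\Gamma$, open balls $V_1,\dots,V_k$ covering $M$, and constants $\sigma<1$, $r>0$ such that, on the $r$-neighbourhood $B_r(V_i)$, $f_i$ is a diffeomorphism onto its image with $\|Df_i(x)^{-1}\|<\sigma$; and there is $0<\eta<r/2$ such that every set of diameter less than $\eta$ lies in some $V_i$, for which the following holds. A word $w=(i_1,\dots,i_n)$, $n\ge1$, is admissible for $x$ if $x\in V_{i_1}$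 and $f_{i_j}\circ\cdots\circ f_{i_1}(x)\in V_{i_{j+1}}$ for $1\le j<n$; put $f_w^n=f_{i_n}\circ\cdots\circ f_{i_1}$, and for a ball $B$ let $f_w^{-n}(B)$ be the preimage of $B$ under the composition of the restrictions $f_{i_j}|_{B_r(V_{i_j})}$. Then for all nonempty open $U,V\subset M$ of diameter less than $\eta/2$ there are a point $x$, an admissible word $w$ of $x$ and $0<\varepsilon<\eta$ such that the ball $B$ of radius $\varepsilon$ centred at $f_w^n(x)$ satisfies $V\subset B$ and $f_w^{-n}(B)\subset U$. Then $\Gamma$ admits an inducing scheme: there are a countable family of nonempty closed sets $M_i\subset M$ with maps $h_i\in\Gamma$ $(i\in I)$ forming a countable Markov partition, i.e. - $\lambda(M\setminus\bigcup_i M_i)=0$ and $M_i=\mathrm{Cl}(\mathrm{int}\,M_i)$; - $\mathrm{int}\,M_i\cap\mathrm{int}\,M_j=\emptyset$ for $i\ne j$; - if $\mathrm{int}\,M_i\cap h_i^{-1}(\mathrm{int}\,M_j)\neq\emptyset$ then $h_i(M_i)\supset M_j$; together with an inducing time $\tau(\mathrm{int}\,M_i)=|h_i|\geq 1$ and the induced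 map $T(x)=h_i(x)$ for $x\in\mathrm{int}\,M_i$ on the open dense set $W=\bigcup_i\mathrm{int}\,M_i$, such that: - (H1) there is $n$ such that $\{h_i(\mathrm{int}\,M_i):i\in I\}$ consists of exactly $n$ open sets (finite images property), and there are $b_1,\dots,b_n\in I$ such that for every $\ell\in I$ there are $i,j\in\{1,\dots,n\}$ with $h_{b_i}(M_{b_i})\supset M_\ell$ and $h_\ell(M_\ell)\supset M_{b_j}$ (finite cycle property); - (H2) for each $i$ there is a connected open set $U\supset M_i$ such that $h_i|_U$ is a diffeomorphism onto its image; - (H3) for every sequence $(i_0,i_1,\dots)$ in $I$ with $\mathrm{int}\,M_{i_k}\cap h_{i_k}^{-1}(\mathrm{int}\,M_{i_{k+1}})\ne\emptyset$ for all $k\geq 0$, the set $M_{i_0}\cap\bigcap_{k\ge1}h_{i_0}^{-1}\circ\cdots\circ h_{i_{k-1}}^{-1}(M_{i_k})$ is a single point; - (H4) there is $0<\sigma<1$ such that $\|Dh_i(x)^{-1}\|<\sigma$ for all $i$ and all $x\in M_i$; - (H5) there is $K>0$ such that $K^{-1}\le\left|\dfrac{\det DT(x)}{\det DT(y)}\right|\le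 K$ for all $i$ and all $x,y\in\mathrm{int}\,M_i$, determinants being taken in orthonormal bases of the tangent spaces. -/

import Mathlib

open Set Metric MeasureTheory Module Bundle
open scoped Manifold ContDiff Topology NNReal ENNReal

noncomputable section

/-! ### Words, generated semigroups, word length -/

/-- The composition `g_{i_n} ∘ ⋯ ∘ g_{i_1}` along the word `(i_1, …, i_n)`; the empty word gives
the identity. -/
def wordMap {A M : Type*} (g : A → M → M) : List A → M → M
  | [] => id
  | i :: w => wordMap g w ∘ g i

/-- The semigroup (under composition, with the identity) generated by the maps `g i`. -/
def generatedSemigroup {A M : Type*} (g : A → M → M) : Set (M → M) :=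
  Set.range (wordMap g)

/-- `h` is the concatenation of `n` generators, i.e. `|h| = n`. -/
def HasWordLength {A M : Type*} (g : A → M → M) (h : M → M) (n : ℕ) : Prop :=
  ∃ w : List A, w.length = n ∧ h = wordMap g w

/-! ### Differentiable maps on a Riemannian manifold of dimension `d` -/

section Manifold

variable {d : ℕ} {M : Type*} [MetricSpace M] [ChartedSpace (EuclideanSpace ℝ (Fin d)) M]

/-- The normalized Lebesgue (Riemannian volume) measure: the `d`-dimensional Hausdorff measure of
the Riemannian distance, divided by its total mass. -/
def normalizedLebesgue (d : ℕ) (M : Type*) [MetricSpace M] [MeasurableSpace M] [BorelSpace M] :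
    Measure M :=
  ((Measure.euclideanHausdorffMeasure d : Measure M) Set.univ)⁻¹ •
    (Measure.euclideanHausdorffMeasure d : Measure M)

/-- `h` is of class `C^{1+α}`: it is `C^1` and, in charts, its derivative is locally
`α`-Hölder continuous. -/
def IsC1Holder (d : ℕ) {M : Type*} [MetricSpace M] [ChartedSpace (EuclideanSpace ℝ (Fin d)) M]
    (α : ℝ≥0) (h : M → M) : Prop :=
  ContMDiff (𝓡 d) (𝓡 d) 1 h ∧
    ∀ x : M, ∃ C : ℝ≥0, ∃ s ∈ 𝓝 (extChartAt (𝓡 d) x x),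
      HolderOnWith C α (fderiv ℝ (writtenInExtChartAt (𝓡 d) (𝓡 d) x h)) s

/-- The restriction of `h` to the open set `U` is a `C^1` diffeomorphism onto its (open) image. -/
def IsDiffeoOntoImage (d : ℕ) {M : Type*} [MetricSpace M]
    [ChartedSpace (EuclideanSpace ℝ (Fin d)) M] (h : M → M) (U : Set M) : Prop :=
  ∃ Φ : PartialDiffeomorph (𝓡 d) (𝓡 d) M M 1, Φ.source = U ∧ EqOn h Φ U

variable [IsManifold (𝓡 d) ∞ M] [RiemannianBundle (fun x : M => TangentSpace (𝓡 d) x)]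

instance finiteDimensional_tangentSpace_model (x : M) :
    FiniteDimensional ℝ (TangentSpace (𝓡 d) x) :=
  inferInstanceAs (FiniteDimensional ℝ (EuclideanSpace ℝ (Fin d)))

/-- `‖Dh(x)⁻¹‖`, for the operator norm of the Riemannian metric. -/
def invDerivNorm (d : ℕ) {M : Type*} [MetricSpace M] [ChartedSpace (EuclideanSpace ℝ (Fin d)) M]
    [IsManifold (𝓡 d) ∞ M] [RiemannianBundle (fun x : M => TangentSpace (𝓡 d) x)]
    (h : M → M) (x : M) : ℝ :=
  ‖(mfderiv (𝓡 d) (𝓡 d) h x).inverse‖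

/-- `|det Dh(x)|`, the determinant being taken in orthonormal bases of `T_x M` and `T_{h x} M`. -/
def absDetDeriv (d : ℕ) {M : Type*} [MetricSpace M] [ChartedSpace (EuclideanSpace ℝ (Fin d)) M]
    [IsManifold (𝓡 d) ∞ M] [RiemannianBundle (fun x : M => TangentSpace (𝓡 d) x)]
    (h : M → M) (x : M) : ℝ :=
  (mfderiv (𝓡 d) (𝓡 d) h x).toLinearMap.normDet

/-- `h` is conformal: each `Dh(x)` is a scalar multiple of a linear isometry. -/
def IsConformalOn (d : ℕ) {M : Type*} [MetricSpace M]
    [ChartedSpace (EuclideanSpace ℝ (Fin d)) M]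
    [IsManifold (𝓡 d) ∞ M] [RiemannianBundle (fun x : M => TangentSpace (𝓡 d) x)]
    (h : M → M) : Prop :=
  ∀ x : M, IsConformalMap (mfderiv (𝓡 d) (𝓡 d) h x)

/-! ### Locally expanding and topologically mixing semigroups -/

/-- The semigroup generated by `g` is locally expanding: every point `x` has some `h` in the
semigroup with co-norm `m(Dh(x)) = ‖Dh(x)⁻¹‖⁻¹ > 1`. -/
def IsLocallyExpanding (d : ℕ) {M : Type*} [MetricSpace M]
    [ChartedSpace (EuclideanSpace ℝ (Fin d)) M]
    [IsManifold (𝓡 d) ∞ M] [RiemannianBundle (fun x : M => TangentSpace (𝓡 d) x)]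
    {N : ℕ} (g : Fin N → M → M) : Prop :=
  ∀ x : M, ∃ h ∈ generatedSemigroup g, 1 < (invDerivNorm d h x)⁻¹

/-- Finitely many elements `f_1, …, f_k` of the semigroup, a cover of `M` by open balls
`V_1, …, V_k`, and constants `σ < 1`, `r > 0` such that `f_i` is an expanding diffeomorphism on
the `r`-neighbourhood of `V_i`; and `0 < η < r / 2` a Lebesgue number of the cover. -/
structure ExpandingCover (d : ℕ) {M : Type*} [MetricSpace M]
    [ChartedSpace (EuclideanSpace ℝ (Fin d)) M]
    [IsManifold (𝓡 d) ∞ M] [RiemannianBundle (fun x : M => TangentSpace (𝓡 d) x)]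
    {N : ℕ} (g : Fin N → M → M) where
  k : ℕ
  f : Fin k → M → M
  center : Fin k → M
  radius : Fin k → ℝ
  σ : ℝ
  r : ℝ
  η : ℝ
  f_mem : ∀ i, f i ∈ generatedSemigroup g
  cover : (⋃ i, ball (center i) (radius i)) = Set.univ
  σ_lt_one : σ < 1
  r_pos : 0 < r
  diffeo : ∀ i, IsDiffeoOntoImage d (f i) (thickening r (ball (center i) (radius i)))
  expanding : ∀ i, ∀ x ∈ thickening r (ball (center i) (radius i)), invDerivNorm d (f i) x < σ
  η_pos : 0 < η
  lebesgue_number : ∀ A : Set M, diam A < η → ∃ i, A ⊆ ball (center i) (radius i)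
  η_lt : η < r / 2

namespace ExpandingCover

variable {N : ℕ} {g : Fin N → M → M}

/-- The ball `V_i`. -/
def V (D : ExpandingCover d g) (i : Fin D.k) : Set M := ball (D.center i) (D.radius i)

/-- `w = (i_1, …, i_n)` is an admissible word of `x`: `n ≥ 1`, `x ∈ V_{i_1}` and
`f_{i_j} ∘ ⋯ ∘ f_{i_1} (x) ∈ V_{i_{j+1}}` for `1 ≤ j < n`. -/
def Admissible (D : ExpandingCover d g) (w : List (Fin D.k)) (x : M) : Prop :=
  w ≠ [] ∧ ∀ (j : ℕ) (hj : j < w.length), wordMap D.f (w.take j) x ∈ D.V w[j]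

/-- The cylinder `f_w^{-n}(B)`, where `f_w^{-n}` is the inverse of the composition of the
diffeomorphisms `f_{i_j}` restricted to the `r`-neighbourhoods of the balls `V_{i_j}`. -/
def cylinder (D : ExpandingCover d g) (w : List (Fin D.k)) (B : Set M) : Set M :=
  {z | (∀ (j : ℕ) (hj : j < w.length), wordMap D.f (w.take j) z ∈ thickening D.r (D.V w[j])) ∧
    wordMap D.f w z ∈ B}

/-- For all nonempty open `U`, `V` of diameter less than `η / 2` there are `x`, an admissible word
`w` of `x` and a ball `B` of radius `ε < η` centred at `f_w(x)` with `V ⊆ B` and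
`f_w^{-n}(B) ⊆ U`. -/
def IsMixing (D : ExpandingCover d g) : Prop :=
  ∀ U V : Set M, IsOpen U → U.Nonempty → diam U < D.η / 2 →
    IsOpen V → V.Nonempty → diam V < D.η / 2 →
    ∃ (x : M) (w : List (Fin D.k)) (ε : ℝ), 0 < ε ∧ ε < D.η ∧ D.Admissible w x ∧
      V ⊆ ball (wordMap D.f w x) ε ∧ D.cylinder w (ball (wordMap D.f w x) ε) ⊆ U

end ExpandingCover

/-- The semigroup generated by `g` is topologically mixing, with respect to some choice of the
expanding cover. -/
def IsTopologicallyMixing (d : ℕ) {M : Type*} [MetricSpace M]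
    [ChartedSpace (EuclideanSpace ℝ (Fin d)) M]
    [IsManifold (𝓡 d) ∞ M] [RiemannianBundle (fun x : M => TangentSpace (𝓡 d) x)]
    {N : ℕ} (g : Fin N → M → M) : Prop :=
  ∃ D : ExpandingCover d g, D.IsMixing

end Manifold

/-! ### Countable Markov partitions and inducing schemes -/

/-- A Markov partition `(M_i, h_i)_{i ∈ ι}` for the semigroup generated by `g`; it is used with a
countable index type `ι`. -/
structure MarkovPartition (d : ℕ) {M : Type*} [MetricSpace M] [MeasurableSpace M] [BorelSpace M]
    {N : ℕ} (g : Fin N → M → M) (ι : Type) where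
  cell : ι → Set M
  map : ι → M → M
  isClosed_cell : ∀ i, IsClosed (cell i)
  nonempty_cell : ∀ i, (cell i).Nonempty
  map_mem : ∀ i, map i ∈ generatedSemigroup g
  full : normalizedLebesgue d M (⋃ i, cell i)ᶜ = 0
  regular : ∀ i, cell i = closure (interior (cell i))
  disjoint : ∀ i j, i ≠ j → interior (cell i) ∩ interior (cell j) = ∅
  markov : ∀ i j, (interior (cell i) ∩ map i ⁻¹' interior (cell j)).Nonempty →
    cell j ⊆ map i '' cell i

namespace MarkovPartition

variable {d : ℕ} {M : Type*} [MetricSpace M] [MeasurableSpace M] [BorelSpace M]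
  {N : ℕ} {g : Fin N → M → M} {ι : Type}

/-- The inducing domain `W = ⋃ i, int M_i`. -/
def domain (P : MarkovPartition d g ι) : Set M := ⋃ i, interior (P.cell i)

/-- Finite images property: the sets `h_i(int M_i)` are exactly `n` open sets `B_1, …, B_n`. -/
def FiniteImages (P : MarkovPartition d g ι) (n : ℕ) : Prop :=
  ∃ B : Fin n → Set M, Function.Injective B ∧ (∀ j, IsOpen (B j)) ∧
    Set.range (fun i => P.map i '' interior (P.cell i)) = Set.range B

/-- Finite cycle property, with `n` distinguished elements `M_{b_1}, …, M_{b_n}`. -/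
def FiniteCycle (P : MarkovPartition d g ι) (n : ℕ) : Prop :=
  ∃ b : Fin n → ι, ∀ l : ι, ∃ i j : Fin n,
    P.cell l ⊆ P.map (b i) '' P.cell (b i) ∧ P.cell (b j) ⊆ P.map l '' P.cell l

/-- `a : ℕ → ι` is a point of the one-sided topological Markov chain of the partition. -/
def IsAdmissibleSeq (P : MarkovPartition d g ι) (a : ℕ → ι) : Prop :=
  ∀ k, (interior (P.cell (a k)) ∩ P.map (a k) ⁻¹' interior (P.cell (a (k + 1)))).Nonempty

/-- `h_{a (k-1)} ∘ ⋯ ∘ h_{a 0}`. -/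
def iterate (P : MarkovPartition d g ι) (a : ℕ → ι) : ℕ → M → M
  | 0 => id
  | k + 1 => P.map (a k) ∘ P.iterate a k

/-- The partition is generating: for each point `a` of the Markov chain the intersection of the
sets `h_{a 0}⁻¹ ∘ ⋯ ∘ h_{a (k-1)}⁻¹ (M_{a k})`, `k ≥ 0`, is a singleton. -/
def Generating (P : MarkovPartition d g ι) : Prop :=
  ∀ a : ℕ → ι, P.IsAdmissibleSeq a →
    ∃ x : M, (⋂ k : ℕ, P.iterate a k ⁻¹' P.cell (a k)) = {x}

end MarkovPartition

/-- `(τ, (M_i, h_i))` is an inducing scheme with induced map `T`, for the semigroup generated by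
`g`. Only the values of `T` on the inducing domain matter. -/
structure IsInducingScheme {d : ℕ} {M : Type*} [MetricSpace M]
    [ChartedSpace (EuclideanSpace ℝ (Fin d)) M]
    [IsManifold (𝓡 d) ∞ M] [RiemannianBundle (fun x : M => TangentSpace (𝓡 d) x)]
    [MeasurableSpace M] [BorelSpace M] {N : ℕ} {g : Fin N → M → M} {ι : Type}
    (P : MarkovPartition d g ι) (τ : ι → ℕ) (T : M → M) : Prop where
  /-- The inducing domain is open and dense. -/
  domain_open_dense : IsOpen P.domain ∧ Dense P.domain
  /-- The inducing time on `int M_i` is positive and is the length of `h_i`. -/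
  time : ∀ i, 0 < τ i ∧ HasWordLength g (P.map i) (τ i)
  /-- The induced map is `h_i` on `int M_i`. -/
  induced : ∀ i, ∀ x ∈ interior (P.cell i), T x = P.map i x
  /-- (H1) finite images and finite cycles. -/
  h1 : ∃ n : ℕ, P.FiniteImages n ∧ P.FiniteCycle n
  /-- (H2) extension. -/
  h2 : ∀ i, ∃ U : Set M, IsOpen U ∧ IsConnected U ∧ P.cell i ⊆ U ∧
    IsDiffeoOntoImage d (P.map i) U
  /-- (H3) generating condition. -/
  h3 : P.Generating
  /-- (H4) uniform expansion; at boundary points of `M_i` the derivative of `T` is that of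
  `h_i`. -/
  h4 : ∃ σ : ℝ, 0 < σ ∧ σ < 1 ∧ ∀ i, ∀ x ∈ P.cell i, invDerivNorm d (P.map i) x < σ
  /-- (H5) bounded distortion. -/
  h5 : ∃ K : ℝ, 0 < K ∧ ∀ i, ∀ x ∈ interior (P.cell i), ∀ y ∈ interior (P.cell i),
    K⁻¹ ≤ absDetDeriv d T x / absDetDeriv d T y ∧ absDetDeriv d T x / absDetDeriv d T y ≤ K

end

/-! ### Conformal local diffeomorphisms -/

section Conformal

variable {d : ℕ} {M : Type*} [MetricSpace M] [ChartedSpace (EuclideanSpace ℝ (Fin d)) M]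
  [IsManifold (𝓡 d) ∞ M] [RiemannianBundle (fun x : M => TangentSpace (𝓡 d) x)]

/-! The scheme is a disjoint union of finitely many full-branch systems. Up to a null set, `M` is
cut into disjoint regular open sets `B_1, …, B_n`, small compared with the Lebesgue number `η`.
Every cell lies in one `B_c` and is mapped onto the closure of that same `B_c`. So the image of a
cell meets only interiors of cells of its own class and then covers them, which gives the Markov
property, finite images and finite cycles at once.

Branches exist near every point `x` and at every scale (`ExpandingCover.exists_return_branches`). A
long admissible word of the expanding maps `f_i` blows up a tiny neighbourhood of `x` to a ball of
radius `η / 2` (`cylinder_ball`). Its distortion is bounded independently of its length: the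
logarithm of the conformal factor is Hölder (`locHolderAt_log_scal`) and inverse branches contract
geometrically (`abs_log_scal_wordMap_sub_le`). Then one of finitely many mixing branches, fixed in
advance for a finite net of `M`, carries part of this ball onto a ball around the closure of `B_c`,
at the cost of a bounded factor.

Full measure comes from the Vitali covering theorem. Since the maps are conformal, one scalar
controls the derivative in all directions, so a cell inside a ball of radius `R` contains a ball of
radius comparable to `R` (`ball_subset_preimage`). The volume is Ahlfors regular (`exists_ahlfors`),
so the cell fills a definite proportion of the ball of radius `3R`. Cells of arbitrarily small size
exist at every point of every `B_c`, hence countably many disjoint ones cover almost everything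
(`exists_returnSystem`).

Uniform expansion makes itineraries determine points, and since the determinant is the `d`-th power
of the conformal factor, (H5) is the distortion bound of the branches. -/

instance nontrivial_tangentSpace_model [NeZero d] (x : M) :
    Nontrivial (TangentSpace (𝓡 d) x) :=
  inferInstanceAs (Nontrivial (EuclideanSpace ℝ (Fin d)))

/-- A local diffeomorphism of class `C^1` which is conformal. -/
structure IsConformalLocalDiffeo (d : ℕ) {M : Type*} [MetricSpace M]
    [ChartedSpace (EuclideanSpace ℝ (Fin d)) M]
    [IsManifold (𝓡 d) ∞ M] [RiemannianBundle (fun x : M => TangentSpace (𝓡 d) x)]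
    (h : M → M) : Prop where
  diffeo : IsLocalDiffeomorph (𝓡 d) (𝓡 d) 1 h
  conformal : IsConformalOn d h

/-- The conformal factor of a conformal map. -/
noncomputable def scal (d : ℕ) {M : Type*} [MetricSpace M]
    [ChartedSpace (EuclideanSpace ℝ (Fin d)) M]
    [IsManifold (𝓡 d) ∞ M] [RiemannianBundle (fun x : M => TangentSpace (𝓡 d) x)]
    (h : M → M) (x : M) : ℝ :=
  ‖mfderiv (𝓡 d) (𝓡 d) h x‖

theorem IsConformalMap.norm_apply_eq {E F : Type*} [NormedAddCommGroup E] [NormedSpace ℝ E]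
    [NormedAddCommGroup F] [NormedSpace ℝ F] [Nontrivial E] {A : E →L[ℝ] F}
    (hA : IsConformalMap A) (v : E) : ‖A v‖ = ‖A‖ * ‖v‖ := by
  obtain ⟨c, -, li, rfl⟩ := hA
  simp [norm_smul, LinearIsometry.norm_toContinuousLinearMap]

theorem IsConformalMap.norm_pos {E F : Type*} [NormedAddCommGroup E] [NormedSpace ℝ E]
    [NormedAddCommGroup F] [NormedSpace ℝ F] [Nontrivial E] {A : E →L[ℝ] F}
    (hA : IsConformalMap A) : 0 < ‖A‖ := by
  obtain ⟨c, hc, li, rfl⟩ := hA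
  simp [norm_smul, LinearIsometry.norm_toContinuousLinearMap, hc]

theorem norm_smul_linearIsometry {E F : Type*} [NormedAddCommGroup E] [NormedSpace ℝ E]
    [NormedAddCommGroup F] [NormedSpace ℝ F] [Nontrivial E] (c : ℝ) (li : E →ₗᵢ[ℝ] F) :
    ‖c • li.toContinuousLinearMap‖ = ‖c‖ := by
  rw [norm_smul, LinearIsometry.norm_toContinuousLinearMap, mul_one]

theorem IsConformalMap.norm_comp_eq {E F G : Type*} [NormedAddCommGroup E] [NormedSpace ℝ E]
    [NormedAddCommGroup F] [NormedSpace ℝ F] [NormedAddCommGroup G] [NormedSpace ℝ G]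
    [Nontrivial E] [Nontrivial F] {A : E →L[ℝ] F} {B : F →L[ℝ] G}
    (hB : IsConformalMap B) (hA : IsConformalMap A) : ‖B ∘L A‖ = ‖B‖ * ‖A‖ := by
  obtain ⟨v, hv⟩ := exists_ne (0 : E)
  have h := (hB.comp hA).norm_apply_eq v
  rw [ContinuousLinearMap.comp_apply, hB.norm_apply_eq, hA.norm_apply_eq, ← mul_assoc] at h
  exact (mul_right_cancel₀ (norm_ne_zero_iff.2 hv) h).symm

theorem norm_inverse_of_conformal {E F : Type*} [NormedAddCommGroup E] [NormedSpace ℝ E]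
    [NormedAddCommGroup F] [NormedSpace ℝ F] [Nontrivial F] {A : E →L[ℝ] F}
    (e : E ≃L[ℝ] F) (he : (e : E →L[ℝ] F) = A) {c : ℝ} (hc : 0 < c)
    (hA : ∀ v, ‖A v‖ = c * ‖v‖) : ‖A.inverse‖ = c⁻¹ := by
  rw [← he, ContinuousLinearMap.inverse_equiv]
  have h2 : ∀ w, ‖e.symm w‖ = c⁻¹ * ‖w‖ := by
    intro w
    have := hA (e.symm w)
    rw [← he] at this
    simp only [ContinuousLinearEquiv.coe_coe, ContinuousLinearEquiv.apply_symm_apply] at this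
    rw [this, ← mul_assoc, inv_mul_cancel₀ hc.ne', one_mul]
  obtain ⟨w, hw⟩ := exists_ne (0 : F)
  refine ContinuousLinearMap.opNorm_eq_of_bounds (by positivity) (fun w => (h2 w).le) ?_
  intro N _ hN
  have h3 := hN w
  simp only [ContinuousLinearEquiv.coe_coe] at h3
  rw [h2] at h3
  exact le_of_mul_le_mul_right h3 (norm_pos_iff.2 hw)

theorem isConformalLocalDiffeo_id : IsConformalLocalDiffeo d (id : M → M) where
  diffeo := (Diffeomorph.refl (𝓡 d) M 1).isLocalDiffeomorph
  conformal x := by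
    rw [mfderiv_id]
    exact isConformalMap_id

namespace IsConformalLocalDiffeo

variable {f h : M → M}

theorem mdifferentiableAt (hh : IsConformalLocalDiffeo d h) (x : M) :
    MDifferentiableAt (𝓡 d) (𝓡 d) h x :=
  hh.diffeo.mdifferentiable one_ne_zero x

theorem continuous (hh : IsConformalLocalDiffeo d h) : Continuous h :=
  hh.diffeo.contMDiff.continuous

theorem isOpenMap (hh : IsConformalLocalDiffeo d h) : IsOpenMap h :=
  hh.diffeo.isOpenMap

theorem comp (hf : IsConformalLocalDiffeo d f) (hh : IsConformalLocalDiffeo d h) :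
    IsConformalLocalDiffeo d (f ∘ h) where
  diffeo x := (hh.diffeo x).comp (P := M) (hg := hf.diffeo (h x))
  conformal x := by
    rw [mfderiv_comp x (hf.mdifferentiableAt _) (hh.mdifferentiableAt x)]
    exact (hf.conformal _).comp (hh.conformal x)

variable [NeZero d]

theorem norm_mfderiv_apply (hh : IsConformalLocalDiffeo d h) (x : M) (v : TangentSpace (𝓡 d) x) :
    ‖mfderiv (𝓡 d) (𝓡 d) h x v‖ = scal d h x * ‖v‖ :=
  (hh.conformal x).norm_apply_eq v

theorem scal_pos (hh : IsConformalLocalDiffeo d h) (x : M) : 0 < scal d h x :=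
  (hh.conformal x).norm_pos

theorem scal_comp (hf : IsConformalLocalDiffeo d f) (hh : IsConformalLocalDiffeo d h) (x : M) :
    scal d (f ∘ h) x = scal d f (h x) * scal d h x := by
  rw [scal, mfderiv_comp x (hf.mdifferentiableAt _) (hh.mdifferentiableAt x)]
  exact (hf.conformal _).norm_comp_eq (hh.conformal x)

theorem invDerivNorm_eq (hh : IsConformalLocalDiffeo d h) (x : M) :
    invDerivNorm d h x = (scal d h x)⁻¹ :=
  norm_inverse_of_conformal ((hh.diffeo x).mfderivToContinuousLinearEquiv one_ne_zero)
    rfl (hh.scal_pos x) (hh.norm_mfderiv_apply x)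

theorem absDetDeriv_eq (hh : IsConformalLocalDiffeo d h) (x : M) :
    absDetDeriv d h x = scal d h x ^ d := by
  have hfr : finrank ℝ (TangentSpace (𝓡 d) x) = d :=
    finrank_euclideanSpace_fin (𝕜 := ℝ) (n := d)
  unfold absDetDeriv scal
  obtain ⟨c, hc, li, h⟩ := hh.conformal x
  rw [h, norm_smul_linearIsometry]
  have : (c • li.toContinuousLinearMap).toLinearMap = c • li.toLinearMap := rfl
  rw [this, LinearMap.normDet_smul, LinearIsometry.normDet_eq_one, hfr, mul_one]

end IsConformalLocalDiffeo

theorem scal_id [NeZero d] (x : M) : scal d (id : M → M) x = 1 := by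
  rw [scal, mfderiv_id]
  exact ContinuousLinearMap.norm_id

theorem absDetDeriv_congr {f h : M → M} {x : M} (hfh : f =ᶠ[𝓝 x] h) :
    absDetDeriv d f x = absDetDeriv d h x := by
  -- The two derivatives take values in the fibres over `f x` and `h x`, whose norms agree only
  -- after transport along `f x = h x`. They are therefore compared as maps of the model space.
  have key : ∀ (y : M) (_ : y = h x)
      (A : EuclideanSpace ℝ (Fin d) →L[ℝ] EuclideanSpace ℝ (Fin d))
      (B : TangentSpace (𝓡 d) x →L[ℝ] TangentSpace (𝓡 d) (h x)), A = B →
      LinearMap.normDet (U := TangentSpace (𝓡 d) x) (V := TangentSpace (𝓡 d) y)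
        (ContinuousLinearMap.toLinearMap (M := TangentSpace (𝓡 d) x)
          (M₂ := TangentSpace (𝓡 d) y) A) = B.toLinearMap.normDet := by
    rintro y rfl A B rfl
    rfl
  exact key (f x) hfh.eq_of_nhds _ _ hfh.mfderiv_eq

/-- A local diffeomorphism which is injective on an open set is a diffeomorphism of that set onto
its image. -/
theorem isDiffeoOntoImage_of_injOn {h : M → M} (hh : IsLocalDiffeomorph (𝓡 d) (𝓡 d) 1 h)
    {S : Set M} (hS : IsOpen S) (hinj : InjOn h S) : IsDiffeoOntoImage d h S := by
  classical
  rcases S.eq_empty_or_nonempty with rfl | ⟨z, hz⟩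
  · refine ⟨⟨⟨id, id, ∅, ∅, by simp, by simp, by simp, by simp⟩, isOpen_empty, isOpen_empty,
      fun x hx => hx.elim, fun x hx => hx.elim⟩, rfl, fun x hx => hx.elim⟩
  have : Nonempty M := ⟨z⟩
  refine ⟨⟨hinj.toPartialEquiv h S, hS, hh.isOpenMap S hS, hh.contMDiff.contMDiffOn, ?_⟩,
    rfl, fun x _ => rfl⟩
  rintro _ ⟨x, hx, rfl⟩
  obtain ⟨Φ, hxΦ, hΦ⟩ := hh x
  have hcont : ContMDiffAt (𝓡 d) (𝓡 d) 1 Φ.invFun (h x) := by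
    refine (Φ.contMDiffOn_invFun).contMDiffAt (Φ.open_target.mem_nhds ?_)
    rw [hΦ hxΦ]
    exact Φ.map_source hxΦ
  refine (hcont.congr_of_eventuallyEq ?_).contMDiffWithinAt
  -- On the image of `S ∩ Φ.source`, injectivity on `S` forces the global inverse to agree with the
  -- local inverse `Φ.invFun`, which is smooth.
  have h1 : h '' (S ∩ Φ.source) ∈ 𝓝 (h x) :=
    (hh.isOpenMap _ (hS.inter Φ.open_source)).mem_nhds ⟨x, ⟨hx, hxΦ⟩, rfl⟩
  filter_upwards [h1]
  rintro _ ⟨y, ⟨hyS, hyΦ⟩, rfl⟩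
  have h2 : Φ.invFun (h y) = y := by
    rw [hΦ hyΦ]
    exact Φ.left_inv hyΦ
  rw [h2]
  exact (hinj.toPartialEquiv h S).left_inv hyS

theorem isConformalLocalDiffeo_of_mem {N : ℕ} {g : Fin N → M → M}
    (hg : ∀ i, IsConformalLocalDiffeo d (g i)) {h : M → M} (hh : h ∈ generatedSemigroup g) :
    IsConformalLocalDiffeo d h := by
  obtain ⟨w, rfl⟩ := hh
  induction w with
  | nil => exact isConformalLocalDiffeo_id
  | cons i w ih => exact ih.comp (hg i)

theorem wordMap_append {A M : Type*} (g : A → M → M) (u v : List A) :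
    wordMap g (u ++ v) = wordMap g v ∘ wordMap g u := by
  induction u with
  | nil => rfl
  | cons i u ih => simp only [List.cons_append, wordMap, ih, Function.comp_assoc]

theorem comp_mem_generatedSemigroup {A M : Type*} {g : A → M → M} {f h : M → M}
    (hf : f ∈ generatedSemigroup g) (hh : h ∈ generatedSemigroup g) :
    f ∘ h ∈ generatedSemigroup g := by
  obtain ⟨u, rfl⟩ := hf
  obtain ⟨v, rfl⟩ := hh
  exact ⟨v ++ u, wordMap_append g v u⟩

theorem wordMap_mem_generatedSemigroup {A B M : Type*} {g : A → M → M} {f : B → M → M}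
    (hf : ∀ i, f i ∈ generatedSemigroup g) (w : List B) :
    wordMap f w ∈ generatedSemigroup g := by
  induction w with
  | nil => exact ⟨[], rfl⟩
  | cons i w ih => exact comp_mem_generatedSemigroup ih (hf i)

end Conformal

/-! ### Lengths of paths and inverse branches -/

section Paths

open Manifold

variable {E H E' H' X Y : Type*} [NormedAddCommGroup E] [NormedSpace ℝ E] [TopologicalSpace H]
  {I : ModelWithCorners ℝ E H} [TopologicalSpace X] [ChartedSpace H X]
  [∀ x : X, ENorm (TangentSpace I x)]
  [NormedAddCommGroup E'] [NormedSpace ℝ E'] [TopologicalSpace H']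
  {J : ModelWithCorners ℝ E' H'}
  [PseudoEMetricSpace Y] [ChartedSpace H' Y] [RiemannianBundle (fun y : Y => TangentSpace J y)]
  [IsRiemannianManifold J Y]

/-- The curve `f ∘ γ` is at most `L` times as long as `γ`, and the Riemannian distance is at most
the length of any joining curve. -/
theorem edist_comp_le_mul_pathELength {f : X → Y} {S : Set X} (hS : IsOpen S)
    (hf : ContMDiffOn I J 1 f S) {L : ℝ≥0}
    (hL : ∀ x ∈ S, ∀ v : TangentSpace I x, ‖mfderiv I J f x v‖ₑ ≤ L * ‖v‖ₑ)
    {γ : ℝ → X} {a b : ℝ} (hγ : ContMDiffOn 𝓘(ℝ, ℝ) I 1 γ (Icc a b)) (hab : a ≤ b)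
    (hmaps : MapsTo γ (Icc a b) S) :
    edist (f (γ a)) (f (γ b)) ≤ L * pathELength I γ a b := by
  rcases hab.eq_or_lt with rfl | hlt
  · simp
  rw [IsRiemannianManifold.out (I := J)]
  refine (riemannianEDist_le_pathELength (γ := f ∘ γ) (hf.comp hγ hmaps) rfl rfl hab).trans ?_
  rw [pathELength_eq_lintegral_mfderivWithin_Icc, pathELength_eq_lintegral_mfderivWithin_Icc,
    ← lintegral_const_mul' _ _ ENNReal.coe_ne_top]
  refine setLIntegral_mono' measurableSet_Icc fun t ht => ?_
  have h1 : mfderivWithin 𝓘(ℝ, ℝ) J (f ∘ γ) (Icc a b) t =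
      (mfderiv I J f (γ t)) ∘L (mfderivWithin 𝓘(ℝ, ℝ) I γ (Icc a b) t) := by
    apply mfderiv_comp_mfderivWithin
    · exact (hf.contMDiffAt (hS.mem_nhds (hmaps ht))).mdifferentiableAt one_ne_zero
    · exact hγ.mdifferentiableOn one_ne_zero t ht
    · rw [uniqueMDiffWithinAt_iff_uniqueDiffWithinAt]
      exact uniqueDiffOn_Icc hlt t ht
  have h2 : mfderivWithin 𝓘(ℝ, ℝ) J (f ∘ γ) (Icc a b) t 1 =
      mfderiv I J f (γ t) (mfderivWithin 𝓘(ℝ, ℝ) I γ (Icc a b) t 1) := congr($h1 1)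
  rw [h2]
  exact hL _ (hmaps ht) _

end Paths

/-! ### Distance estimates by almost minimizing paths -/

section RiemannianPaths

open Manifold

variable {E H X : Type*} [NormedAddCommGroup E] [NormedSpace ℝ E] [TopologicalSpace H]
  {I : ModelWithCorners ℝ E H} [PseudoMetricSpace X] [ChartedSpace H X]
  [RiemannianBundle (fun x : X => TangentSpace I x)] [IsRiemannianManifold I X]

variable (I) in
theorem exists_contMDiff_path_lt {x y : X} {l : ℝ≥0} (h : dist x y < l) :
    ∃ γ : ℝ → X, γ 0 = x ∧ γ 1 = y ∧ ContMDiff 𝓘(ℝ, ℝ) I 1 γ ∧ pathELength I γ 0 1 < l := by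
  have h1 : riemannianEDist I x y < l := by
    rw [← IsRiemannianManifold.out (I := I), edist_lt_coe]
    exact_mod_cast h
  obtain ⟨γ, h0, h1, h2, h3, -⟩ := exists_lt_locally_constant_of_riemannianEDist_lt h1 zero_lt_one
  exact ⟨γ, h0, h1, h2, h3⟩

theorem edist_le_pathELength [IsManifold I 1 X] {γ : ℝ → X} (hγ : ContMDiff 𝓘(ℝ, ℝ) I 1 γ)
    {a b : ℝ} (hab : a ≤ b) : edist (γ a) (γ b) ≤ pathELength I γ a b := by
  rw [IsRiemannianManifold.out (I := I)]
  exact riemannianEDist_le_pathELength hγ.contMDiffOn rfl rfl hab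

theorem dist_lt_of_pathELength_lt [IsManifold I 1 X] {γ : ℝ → X} (hγ : ContMDiff 𝓘(ℝ, ℝ) I 1 γ)
    {l : ℝ≥0} (hl : pathELength I γ 0 1 < l) {t : ℝ} (ht : t ∈ Icc (0 : ℝ) 1) :
    dist (γ 0) (γ t) < l := by
  have h1 : edist (γ 0) (γ t) < l :=
    ((edist_le_pathELength hγ ht.1).trans (pathELength_mono le_rfl ht.2)).trans_lt hl
  rw [edist_lt_coe] at h1
  exact_mod_cast h1

variable (I) in
theorem isConnected_ball_of_riemannian [IsManifold I 1 X] (x : X) {r : ℝ} (hr : 0 < r) :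
    IsConnected (ball x r) := by
  refine ⟨⟨x, mem_ball_self hr⟩, isPreconnected_of_forall x fun y hy => ?_⟩
  lift r to ℝ≥0 using hr.le
  obtain ⟨γ, h0, h1, h2, h3⟩ := exists_contMDiff_path_lt I (mem_ball'.1 hy)
  refine ⟨γ '' Icc 0 1, ?_, ⟨0, by simp, h0⟩, ⟨1, by simp, h1⟩,
    isPreconnected_Icc.image _ h2.continuous.continuousOn⟩
  rintro _ ⟨t, ht, rfl⟩
  rw [mem_ball', ← h0]
  exact dist_lt_of_pathELength_lt h2 h3 ht

/-- A map whose derivative is bounded by `L` on a ball is `L`-Lipschitz between points that are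
closer to each other than to the complement of the ball. -/
theorem dist_le_mul_of_norm_mfderiv_le [IsManifold I 1 X] {E' H' Y : Type*}
    [NormedAddCommGroup E'] [NormedSpace ℝ E'] [TopologicalSpace H']
    {J : ModelWithCorners ℝ E' H'}
    [PseudoMetricSpace Y] [ChartedSpace H' Y] [RiemannianBundle (fun y : Y => TangentSpace J y)]
    [IsRiemannianManifold J Y] {f : X → Y} {S : Set X} (hS : IsOpen S)
    (hf : ContMDiffOn I J 1 f S) {L : ℝ≥0}
    (hL : ∀ x ∈ S, ∀ v : TangentSpace I x, ‖mfderiv I J f x v‖ ≤ L * ‖v‖)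
    {x y : X} {R : ℝ} (hR : ball x R ⊆ S) (hxy : dist x y < R) :
    dist (f x) (f y) ≤ L * dist x y := by
  have hL' : ∀ x ∈ S, ∀ v : TangentSpace I x, ‖mfderiv I J f x v‖ₑ ≤ L * ‖v‖ₑ := by
    intro x hx v
    have h1 : ‖mfderiv I J f x v‖₊ ≤ L * ‖v‖₊ := hL x hx v
    simp only [enorm]
    exact_mod_cast h1
  refine le_of_forall_gt_imp_ge_of_dense fun c hc => ?_
  -- The distance is only an infimum of lengths, so the bound is proved for every `l > dist x y` and
  -- then `l` tends to `dist x y`.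
  have key : ∀ l : ℝ, dist x y < l → l < R → dist (f x) (f y) ≤ L * l := by
    intro l hl hlR
    lift l to ℝ≥0 using dist_nonneg.trans hl.le
    obtain ⟨γ, h0, h1, h2, h3⟩ := exists_contMDiff_path_lt I hl
    have hm : MapsTo γ (Icc 0 1) S := by
      intro t ht
      apply hR
      rw [mem_ball', ← h0]
      exact (dist_lt_of_pathELength_lt h2 h3 ht).trans hlR
    have h4 := edist_comp_le_mul_pathELength hS hf hL' h2.contMDiffOn zero_le_one hm
    rw [h0, h1] at h4
    have h5 : edist (f x) (f y) ≤ (L * l : ℝ≥0) := by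
      push_cast
      exact h4.trans (by gcongr)
    rw [edist_le_coe] at h5
    exact_mod_cast h5
  have ht : Filter.Tendsto (fun l : ℝ => (L : ℝ) * l) (𝓝[>] (dist x y)) (𝓝 (L * dist x y)) :=
    ((continuous_const.mul continuous_id).tendsto _).mono_left nhdsWithin_le_nhds
  have h6 : ∀ᶠ l in 𝓝[>] (dist x y), (L : ℝ) * l < c := ht.eventually (gt_mem_nhds hc)
  obtain ⟨l, ⟨h7, h8⟩, h9⟩ := ((h6.and (nhdsWithin_le_nhds (gt_mem_nhds hxy))).and
    self_mem_nhdsWithin).exists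
  exact (key l h9 h8).trans h7.le

/-- Path lifting: a map with inverse `k` on `T` and with derivative bounded by `L` on `S` maps
the points of `X` close to `u ∈ S` into the balls around `f u` that `T` contains. -/
theorem mem_of_mul_dist_lt [IsManifold I 1 X] {E' H' Y : Type*}
    [NormedAddCommGroup E'] [NormedSpace ℝ E'] [TopologicalSpace H']
    {J : ModelWithCorners ℝ E' H'}
    [PseudoMetricSpace Y] [ProperSpace Y] [T2Space X]
    [ChartedSpace H' Y] [RiemannianBundle (fun y : Y => TangentSpace J y)]
    [IsRiemannianManifold J Y] {f : X → Y} {k : Y → X} {S : Set X} {T : Set Y} (hS : IsOpen S)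
    (hf : ContMDiffOn I J 1 f S) (hk : ContinuousOn k T) (hkT : MapsTo k T S)
    (hkf : ∀ x ∈ S, k (f x) = x) {L : ℝ≥0}
    (hL : ∀ x ∈ S, ∀ v : TangentSpace I x, ‖mfderiv I J f x v‖ ≤ L * ‖v‖)
    {u v : X} (hu : u ∈ S) {ρ : ℝ} (hρ : closedBall (f u) ρ ⊆ T) (huv : L * dist u v < ρ) :
    v ∈ S ∧ dist (f u) (f v) ≤ L * dist u v := by
  have hL' : ∀ x ∈ S, ∀ v : TangentSpace I x, ‖mfderiv I J f x v‖ₑ ≤ L * ‖v‖ₑ := by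
    intro x hx v
    have h1 : ‖mfderiv I J f x v‖₊ ≤ L * ‖v‖₊ := hL x hx v
    simp only [enorm]
    exact_mod_cast h1
  have key : ∀ l : ℝ, dist u v < l → L * l < ρ → v ∈ S ∧ dist (f u) (f v) ≤ L * l := by
    intro l hl hlρ
    lift l to ℝ≥0 using dist_nonneg.trans hl.le
    obtain ⟨γ, h0, h1, h2, h3⟩ := exists_contMDiff_path_lt I hl
    have hdist : ∀ t ∈ Icc (0 : ℝ) 1, MapsTo γ (Icc 0 t) S → dist (f u) (f (γ t)) ≤ L * l := by
      intro t ht hm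
      have h4 := edist_comp_le_mul_pathELength hS hf hL' h2.contMDiffOn ht.1 hm
      rw [h0] at h4
      have h5 : edist (f u) (f (γ t)) ≤ (L * l : ℝ≥0) := by
        push_cast
        exact h4.trans (by gcongr; exact (pathELength_mono le_rfl ht.2).trans h3.le)
      rw [edist_le_coe] at h5
      exact_mod_cast h5
    have hρ0 : 0 ≤ ρ := le_trans (by positivity) hlρ.le
    have hK : IsCompact (k '' closedBall (f u) ρ) :=
      (isCompact_closedBall _ _).image_of_continuousOn (hk.mono hρ)
    have hKS : k '' closedBall (f u) ρ ⊆ S := by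
      rintro _ ⟨y, hy, rfl⟩
      exact hkT (hρ hy)
    -- Continuity induction along `γ`. The condition is closed in time because the image under `k`
    -- is compact. It persists to the right because the image curve so far has length less than `ρ`,
    -- so `f (γ t)` is in the open ball.
    have hsub : Icc (0 : ℝ) 1 ⊆ γ ⁻¹' (k '' closedBall (f u) ρ) := by
      have hcl : IsClosed (γ ⁻¹' (k '' closedBall (f u) ρ) ∩ Icc 0 1) :=
        (hK.isClosed.preimage h2.continuous).inter isClosed_Icc
      refine hcl.Icc_subset_of_forall_mem_nhdsGT_of_Icc_subset ?_ ?_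
      · exact ⟨f u, mem_closedBall_self hρ0, by rw [hkf u hu, h0]⟩
      · rintro t ht htK
        have hm : MapsTo γ (Icc 0 t) S := fun s hs => hKS (htK hs)
        have h5 := hdist t ⟨ht.1, ht.2.le⟩ hm
        have htS : γ t ∈ S := hm ⟨ht.1, le_rfl⟩
        have hnhds : S ∩ f ⁻¹' ball (f u) ρ ∈ 𝓝 (γ t) := by
          refine (hf.continuousOn.isOpen_inter_preimage hS isOpen_ball).mem_nhds ⟨htS, ?_⟩
          exact mem_ball'.2 (h5.trans_lt hlρ)
        refine h2.continuous.continuousWithinAt (Filter.mem_of_superset hnhds ?_)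
        rintro z ⟨hzS, hz⟩
        exact ⟨f z, ball_subset_closedBall hz, hkf z hzS⟩
    have hm : MapsTo γ (Icc 0 1) S := fun s hs => hKS (hsub hs)
    have h6 := hdist 1 (by simp) hm
    rw [h1] at h6
    refine ⟨?_, h6⟩
    rw [← h1]
    exact hm (by simp)
  have ht : Filter.Tendsto (fun l : ℝ => (L : ℝ) * l) (𝓝[>] (dist u v)) (𝓝 (L * dist u v)) :=
    ((continuous_const.mul continuous_id).tendsto _).mono_left nhdsWithin_le_nhds
  have h6 : ∀ᶠ l in 𝓝[>] (dist u v), (L : ℝ) * l < ρ := ht.eventually (gt_mem_nhds huv)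
  constructor
  · obtain ⟨l, h7, h8⟩ := (h6.and self_mem_nhdsWithin).exists
    exact (key l h8 h7).1
  · refine ge_of_tendsto ht ?_
    filter_upwards [h6, self_mem_nhdsWithin] with l h7 h8
    exact (key l h8 h7).2

end RiemannianPaths

/-! ### Distance estimates for conformal local diffeomorphisms -/

section ConformalDist

variable {d : ℕ} {M : Type*} [MetricSpace M] [ChartedSpace (EuclideanSpace ℝ (Fin d)) M]
  [IsManifold (𝓡 d) ∞ M] [RiemannianBundle (fun x : M => TangentSpace (𝓡 d) x)]

theorem norm_mfderiv_congr {f h : M → M} {x : M} (hfh : f =ᶠ[𝓝 x] h)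
    (v : TangentSpace (𝓡 d) x) :
    ‖mfderiv (𝓡 d) (𝓡 d) f x v‖ = ‖mfderiv (𝓡 d) (𝓡 d) h x v‖ := by
  have key : ∀ (y : M) (_ : y = h x)
      (A : EuclideanSpace ℝ (Fin d) →L[ℝ] EuclideanSpace ℝ (Fin d))
      (B : TangentSpace (𝓡 d) x →L[ℝ] TangentSpace (𝓡 d) (h x)), A = B →
      norm (E := TangentSpace (𝓡 d) y) (A v) = ‖B v‖ := by
    rintro y rfl A B rfl
    rfl
  exact key (f x) hfh.eq_of_nhds _ _ hfh.mfderiv_eq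

namespace IsConformalLocalDiffeo

variable [NeZero d] {h : M → M}

/-- Differentiating `h ∘ k = id` shows that the inverse branch scales norms by the reciprocal of the
conformal factor. -/
theorem exists_inverse (hh : IsConformalLocalDiffeo d h) {S : Set M} (hS : IsOpen S)
    (hinj : InjOn h S) :
    ∃ k : M → M, ContMDiffOn (𝓡 d) (𝓡 d) 1 k (h '' S) ∧ (∀ x ∈ S, k (h x) = x) ∧
      ∀ x ∈ S, ∀ w : TangentSpace (𝓡 d) (h x),
        ‖mfderiv (𝓡 d) (𝓡 d) k (h x) w‖ = (scal d h x)⁻¹ * ‖w‖ := by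
  obtain ⟨Φ, rfl, hΦ⟩ := isDiffeoOntoImage_of_injOn hh.diffeo hS hinj
  have himg : h '' Φ.source = Φ.target := by
    rw [hΦ.image_eq]
    exact Φ.toPartialEquiv.image_source_eq_target
  have hkh : ∀ x ∈ Φ.source, Φ.invFun (h x) = x := fun x hx => by
    rw [hΦ hx]; exact Φ.left_inv hx
  refine ⟨Φ.invFun, himg ▸ Φ.contMDiffOn_invFun, hkh, fun x hx w => ?_⟩
  have hxT : h x ∈ Φ.target := himg ▸ mem_image_of_mem h hx
  have hk : MDifferentiableAt (𝓡 d) (𝓡 d) Φ.invFun (h x) :=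
    (Φ.contMDiffOn_invFun.contMDiffAt (Φ.open_target.mem_nhds hxT)).mdifferentiableAt one_ne_zero
  have h1 : h ∘ Φ.invFun =ᶠ[𝓝 (h x)] id := by
    filter_upwards [Φ.open_target.mem_nhds hxT] with y hy
    have h2 : Φ.invFun y ∈ Φ.source := Φ.map_target hy
    change h (Φ.invFun y) = y
    rw [hΦ h2]
    exact Φ.right_inv hy
  have h2 := norm_mfderiv_congr h1 w
  rw [mfderiv_comp _ (hh.mdifferentiableAt _) hk, mfderiv_id] at h2
  have h3 : scal d h (Φ.invFun (h x)) * ‖mfderiv (𝓡 d) (𝓡 d) Φ.invFun (h x) w‖ = ‖w‖ := by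
    rw [← hh.norm_mfderiv_apply]
    exact h2
  have h4 : scal d h (Φ.invFun (h x)) = scal d h x := by rw [hkh x hx]
  rw [← h4, ← h3, ← mul_assoc, inv_mul_cancel₀ (hh.scal_pos _).ne', one_mul]

variable [IsRiemannianManifold (𝓡 d) M]

/-- An expanding map has a contracting inverse branch on a large ball. -/
theorem exists_preimage [ProperSpace M] (hh : IsConformalLocalDiffeo d h) {S : Set M}
    (hS : IsOpen S) (hinj : InjOn h S) {c : ℝ} (hc : 0 < c) (hcS : ∀ x ∈ S, c ≤ scal d h x)
    {x y : M} (hx : x ∈ S) {ρ : ℝ} (hρ : closedBall x ρ ⊆ S) (hxy : dist (h x) y < c * ρ) :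
    ∃ z ∈ S, h z = y ∧ c * dist x z ≤ dist (h x) y := by
  obtain ⟨k, hk, hkh, hkn⟩ := hh.exists_inverse hS hinj
  have hkx := hkh x hx
  -- The roles are exchanged: the map with bounded derivative is the inverse branch `k`, with
  -- constant `c⁻¹`, and `h` is its continuous inverse. Thus `y` is found in `h '' S`.
  have key := mem_of_mul_dist_lt (I := 𝓡 d) (J := 𝓡 d) (f := k) (k := h) (S := h '' S) (T := S)
    (L := ⟨c⁻¹, by positivity⟩) (hh.isOpenMap S hS) hk hh.continuous.continuousOn
    (mapsTo_image h S) (by rintro _ ⟨z, hz, rfl⟩; rw [hkh z hz]) (by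
      rintro _ ⟨z, hz, rfl⟩ v
      rw [hkn z hz]
      gcongr
      exact inv_anti₀ hc (hcS z hz))
    (u := h x) (v := y) ⟨x, hx, rfl⟩ (ρ := ρ) (by rwa [hkx]) (by
      change c⁻¹ * _ < ρ
      rwa [inv_mul_lt_iff₀ hc])
  obtain ⟨⟨z, hz, rfl⟩, h2⟩ := key
  refine ⟨z, hz, rfl, ?_⟩
  rw [hkx, hkh z hz] at h2
  change dist x z ≤ c⁻¹ * _ at h2
  rwa [inv_mul_eq_div, le_div_iff₀' hc] at h2

/-- An upper bound on the conformal factor prevents a short path from leaving `S`, as its image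
cannot leave the ball around `h u`. This yields balls inside domains of branches. -/
theorem mem_of_dist_lt [ProperSpace M] (hh : IsConformalLocalDiffeo d h) {S : Set M}
    (hS : IsOpen S) (hinj : InjOn h S) {L : ℝ} (hL : 0 ≤ L) (hLS : ∀ x ∈ S, scal d h x ≤ L)
    {u v : M} (hu : u ∈ S) {ρ : ℝ} (hρ : closedBall (h u) ρ ⊆ h '' S) (huv : L * dist u v < ρ) :
    v ∈ S := by
  obtain ⟨k, hk, hkh, -⟩ := hh.exists_inverse hS hinj
  exact (mem_of_mul_dist_lt (I := 𝓡 d) (J := 𝓡 d) (f := h) (k := k) (S := S) (T := h '' S)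
    (L := ⟨L, hL⟩) hS hh.diffeo.contMDiff.contMDiffOn hk.continuousOn
    (by rintro _ ⟨z, hz, rfl⟩; rwa [hkh z hz]) hkh (by
      intro x hx v
      rw [hh.norm_mfderiv_apply]
      gcongr
      exact hLS x hx) hu hρ huv).1

/-- The inverse branch has derivative at most `c⁻¹`, hence is `c⁻¹`-Lipschitz from the centre of any
ball inside the image. -/
theorem mul_dist_le (hh : IsConformalLocalDiffeo d h) {S : Set M}
    (hS : IsOpen S) (hinj : InjOn h S) {c : ℝ} (hc : 0 < c) (hcS : ∀ x ∈ S, c ≤ scal d h x)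
    {z z' : M} (hz : z ∈ S) (hz' : z' ∈ S) {R : ℝ} (hR : ball (h z) R ⊆ h '' S)
    (hzz : dist (h z) (h z') < R) : c * dist z z' ≤ dist (h z) (h z') := by
  obtain ⟨k, hk, hkh, hkn⟩ := hh.exists_inverse hS hinj
  have key := dist_le_mul_of_norm_mfderiv_le (I := 𝓡 d) (J := 𝓡 d) (f := k) (S := h '' S)
    (L := ⟨c⁻¹, by positivity⟩) (hh.isOpenMap S hS) hk (by
      rintro _ ⟨z, hz, rfl⟩ v
      rw [hkn z hz]
      gcongr
      exact inv_anti₀ hc (hcS z hz)) hR hzz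
  rw [hkh z hz, hkh z' hz'] at key
  change dist z z' ≤ c⁻¹ * _ at key
  rwa [inv_mul_eq_div, le_div_iff₀' hc] at key

theorem dist_le_of_scal_le (hh : IsConformalLocalDiffeo d h) {A : ℝ} (hA : 0 ≤ A)
    (hAS : ∀ x, scal d h x ≤ A) (x y : M) : dist (h x) (h y) ≤ A * dist x y :=
  dist_le_mul_of_norm_mfderiv_le (I := 𝓡 d) (J := 𝓡 d) (f := h) (S := Set.univ)
    (L := ⟨A, hA⟩) isOpen_univ hh.diffeo.contMDiff.contMDiffOn (by
      intro x _ v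
      rw [hh.norm_mfderiv_apply]
      gcongr
      exact hAS x) (subset_univ _) (lt_add_one (dist x y))

end IsConformalLocalDiffeo

end ConformalDist

/-! ### Charts are locally bi-Lipschitz -/

section ChartLipschitz

variable {d : ℕ} {M : Type*} [MetricSpace M] [ChartedSpace (EuclideanSpace ℝ (Fin d)) M]
  [IsManifold (𝓡 d) ∞ M] [RiemannianBundle (fun x : M => TangentSpace (𝓡 d) x)]
  [IsContMDiffRiemannianBundle (𝓡 d) ∞ (EuclideanSpace ℝ (Fin d))
    (fun x : M => TangentSpace (𝓡 d) x)]

instance isContinuousRiemannianBundle_tangentSpace_model :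
    IsContinuousRiemannianBundle (EuclideanSpace ℝ (Fin d))
      (fun x : M => TangentSpace (𝓡 d) x) where
  exists_continuous := by
    obtain ⟨G, hG, h⟩ := IsContMDiffRiemannianBundle.exists_contMDiff (IB := 𝓡 d) (n := ∞)
      (F := EuclideanSpace ℝ (Fin d)) (E := fun x : M => TangentSpace (𝓡 d) x)
    exact ⟨G, hG.continuous, h⟩

theorem eventually_norm_mfderiv_extChartAt_apply_le (d : ℕ) {M : Type*} [MetricSpace M]
    [ChartedSpace (EuclideanSpace ℝ (Fin d)) M]
    [IsManifold (𝓡 d) ∞ M] [RiemannianBundle (fun x : M => TangentSpace (𝓡 d) x)]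
    [IsContMDiffRiemannianBundle (𝓡 d) ∞ (EuclideanSpace ℝ (Fin d))
      (fun x : M => TangentSpace (𝓡 d) x)] (x : M) :
    ∃ C : ℝ≥0, ∀ᶠ y in 𝓝 x, ∀ v : TangentSpace (𝓡 d) y,
      ‖mfderiv (𝓡 d) 𝓘(ℝ, EuclideanSpace ℝ (Fin d)) (extChartAt (𝓡 d) x) y v‖ ≤ C * ‖v‖ := by
  obtain ⟨C, C_pos, hC⟩ := eventually_norm_trivializationAt_lt (EuclideanSpace ℝ (Fin d))
    (fun x : M => TangentSpace (𝓡 d) x) x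
  refine ⟨⟨C, C_pos.le⟩, ?_⟩
  filter_upwards [hC, chart_source_mem_nhds (EuclideanSpace ℝ (Fin d)) x] with y hy h'y v
  rw [norm_tangentSpace_vectorSpace, ← TangentBundle.continuousLinearMapAt_trivializationAt h'y]
  exact (ContinuousLinearMap.le_opNorm _ v).trans (by gcongr; exact hy.le)

theorem exists_extChartAt_lipschitz (d : ℕ) {M : Type*} [MetricSpace M]
    [ChartedSpace (EuclideanSpace ℝ (Fin d)) M]
    [IsManifold (𝓡 d) ∞ M] [RiemannianBundle (fun x : M => TangentSpace (𝓡 d) x)]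
    [IsContMDiffRiemannianBundle (𝓡 d) ∞ (EuclideanSpace ℝ (Fin d))
      (fun x : M => TangentSpace (𝓡 d) x)]
    [IsRiemannianManifold (𝓡 d) M] (x : M) :
    ∃ C : ℝ≥0, ∃ ρ > 0, ball x ρ ⊆ (extChartAt (𝓡 d) x).source ∧
      LipschitzOnWith C (extChartAt (𝓡 d) x) (ball x ρ) := by
  obtain ⟨C, hC⟩ := eventually_norm_mfderiv_extChartAt_apply_le d x
  obtain ⟨ρ, hρ, hb⟩ := Metric.mem_nhds_iff.1
    (Filter.inter_mem hC (extChartAt_source_mem_nhds (I := 𝓡 d) x))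
  have hsrc : ball x ρ ⊆ (extChartAt (𝓡 d) x).source := fun y hy => (hb hy).2
  -- Points of the ball of radius `ρ / 3` are less than `2ρ / 3` apart, and the ball of radius `2ρ /
  -- 3` around each of them stays in the ball of radius `ρ`.
  refine ⟨C, ρ / 3, by positivity, (ball_subset_ball (by linarith)).trans hsrc, ?_⟩
  refine LipschitzOnWith.of_dist_le_mul fun y hy z hz => ?_
  refine dist_le_mul_of_norm_mfderiv_le (I := 𝓡 d) (J := 𝓘(ℝ, EuclideanSpace ℝ (Fin d)))
    (S := ball x ρ) isOpen_ball ?_ (fun y hy v => (hb hy).1 v) (R := 2 * ρ / 3) ?_ ?_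
  · refine (contMDiffOn_extChartAt (I := 𝓡 d) (x := x)).mono ?_
    rwa [extChartAt_source] at hsrc
  · refine ball_subset_ball' ?_
    rw [mem_ball] at hy
    linarith
  · rw [mem_ball] at hy hz
    linarith [dist_triangle_right y z x]

section

attribute [local instance] normedAddCommGroupTangentSpaceVectorSpace
  normedSpaceTangentSpaceVectorSpace

/-- Here tangent vectors of the model space carry its own norm; the version for the Riemannian norm
follows. -/
theorem eventually_norm_mfderiv_extChartAt_symm_apply_le_aux (d : ℕ) {M : Type*} [MetricSpace M]
    [ChartedSpace (EuclideanSpace ℝ (Fin d)) M]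
    [IsManifold (𝓡 d) ∞ M] [RiemannianBundle (fun x : M => TangentSpace (𝓡 d) x)]
    [IsContMDiffRiemannianBundle (𝓡 d) ∞ (EuclideanSpace ℝ (Fin d))
      (fun x : M => TangentSpace (𝓡 d) x)] (x : M) :
    ∃ C : ℝ≥0, ∀ᶠ y in 𝓝 (extChartAt (𝓡 d) x x), ∀ v : EuclideanSpace ℝ (Fin d),
      ‖mfderiv 𝓘(ℝ, EuclideanSpace ℝ (Fin d)) (𝓡 d) (extChartAt (𝓡 d) x).symm y v‖ ≤
        C * ‖v‖ := by
  obtain ⟨C, C_pos, hC⟩ := eventually_norm_mfderivWithin_symm_extChartAt_lt (𝓡 d) x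
  refine ⟨⟨C, C_pos.le⟩, ?_⟩
  simp only [ModelWithCorners.range_eq_univ, nhdsWithin_univ] at hC
  filter_upwards [hC] with y hy v
  rw [mfderivWithin_univ] at hy
  exact (ContinuousLinearMap.le_opNorm _ v).trans (by gcongr; exact hy.le)

end

theorem eventually_norm_mfderiv_extChartAt_symm_apply_le (d : ℕ) {M : Type*} [MetricSpace M]
    [ChartedSpace (EuclideanSpace ℝ (Fin d)) M]
    [IsManifold (𝓡 d) ∞ M] [RiemannianBundle (fun x : M => TangentSpace (𝓡 d) x)]
    [IsContMDiffRiemannianBundle (𝓡 d) ∞ (EuclideanSpace ℝ (Fin d))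
      (fun x : M => TangentSpace (𝓡 d) x)] (x : M) :
    ∃ C : ℝ≥0, ∀ᶠ y in 𝓝 (extChartAt (𝓡 d) x x),
      ∀ v : TangentSpace 𝓘(ℝ, EuclideanSpace ℝ (Fin d)) y,
      ‖mfderiv 𝓘(ℝ, EuclideanSpace ℝ (Fin d)) (𝓡 d) (extChartAt (𝓡 d) x).symm y v‖ ≤
        C * ‖v‖ := by
  obtain ⟨C, hC⟩ := eventually_norm_mfderiv_extChartAt_symm_apply_le_aux d x
  refine ⟨C, ?_⟩
  filter_upwards [hC] with y hy v
  rw [norm_tangentSpace_vectorSpace (v := v)]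
  exact hy v

theorem exists_extChartAt_symm_lipschitz (d : ℕ) {M : Type*} [MetricSpace M]
    [ChartedSpace (EuclideanSpace ℝ (Fin d)) M]
    [IsManifold (𝓡 d) ∞ M] [RiemannianBundle (fun x : M => TangentSpace (𝓡 d) x)]
    [IsContMDiffRiemannianBundle (𝓡 d) ∞ (EuclideanSpace ℝ (Fin d))
      (fun x : M => TangentSpace (𝓡 d) x)]
    [IsRiemannianManifold (𝓡 d) M] (x : M) :
    ∃ C : ℝ≥0, ∃ ρ > 0, ball (extChartAt (𝓡 d) x x) ρ ⊆ (extChartAt (𝓡 d) x).target ∧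
      LipschitzOnWith C (extChartAt (𝓡 d) x).symm (ball (extChartAt (𝓡 d) x x) ρ) := by
  obtain ⟨C, hC⟩ := eventually_norm_mfderiv_extChartAt_symm_apply_le d x
  obtain ⟨ρ, hρ, hb⟩ := Metric.mem_nhds_iff.1
    (Filter.inter_mem hC (extChartAt_target_mem_nhds (I := 𝓡 d) x))
  have htgt : ball (extChartAt (𝓡 d) x x) ρ ⊆ (extChartAt (𝓡 d) x).target :=
    fun y hy => (hb hy).2
  refine ⟨C, ρ / 3, by positivity, (ball_subset_ball (by linarith)).trans htgt, ?_⟩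
  refine LipschitzOnWith.of_dist_le_mul fun y hy z hz => ?_
  refine dist_le_mul_of_norm_mfderiv_le (I := 𝓘(ℝ, EuclideanSpace ℝ (Fin d))) (J := 𝓡 d)
    (S := ball (extChartAt (𝓡 d) x x) ρ) isOpen_ball ((contMDiffOn_extChartAt_symm x).mono htgt)
    (fun y hy v => (hb hy).1 v) (R := 2 * ρ / 3) ?_ ?_
  · refine ball_subset_ball' ?_
    rw [mem_ball] at hy
    linarith
  · rw [mem_ball] at hy hz
    linarith [dist_triangle_right y z (extChartAt (𝓡 d) x x)]

end ChartLipschitz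

/-! ### Hölder continuity of the conformal factors -/

section LocHolder

/-- `u` is `α`-Hölder continuous in a neighbourhood of `x`. -/
def LocHolderAt {X F : Type*} [PseudoMetricSpace X] [PseudoMetricSpace F] (α : ℝ≥0) (u : X → F)
    (x : X) : Prop :=
  ∃ C : ℝ≥0, ∃ s ∈ 𝓝 x, HolderOnWith C α u s

variable {X Y F G : Type*} [PseudoMetricSpace X] [PseudoMetricSpace Y] [PseudoMetricSpace F]
  [PseudoMetricSpace G] {α : ℝ≥0} {u : X → F} {x : X}

namespace LocHolderAt

theorem continuousAt (hα : 0 < α) (hu : LocHolderAt α u x) : ContinuousAt u x := by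
  obtain ⟨C, s, hs, h⟩ := hu
  exact (h.continuousOn hα).continuousAt hs

theorem congr {v : X → F} (hu : LocHolderAt α u x) (huv : v =ᶠ[𝓝 x] u) : LocHolderAt α v x := by
  obtain ⟨C, s, hs, h⟩ := hu
  refine ⟨C, s ∩ {y | v y = u y}, Filter.inter_mem hs huv, ?_⟩
  rintro y ⟨hy, hy'⟩ z ⟨hz, hz'⟩
  rw [hy', hz']
  exact h y hy z hz

theorem prodMk {v : X → G} (hu : LocHolderAt α u x) (hv : LocHolderAt α v x) :
    LocHolderAt α (fun y => (u y, v y)) x := by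
  obtain ⟨C, s, hs, h⟩ := hu
  obtain ⟨C', s', hs', h'⟩ := hv
  refine ⟨max C C', s ∩ s', Filter.inter_mem hs hs', ?_⟩
  rintro y ⟨hy, hy'⟩ z ⟨hz, hz'⟩
  rw [Prod.edist_eq]
  refine max_le ((h y hy z hz).trans ?_) ((h' y hy' z hz').trans ?_)
  · gcongr
    exact le_max_left _ _
  · gcongr
    exact le_max_right _ _

theorem lipschitz_comp (hα : 0 < α) (hu : LocHolderAt α u x) {φ : F → G} {K : ℝ≥0} {t : Set F}
    (ht : t ∈ 𝓝 (u x)) (hφ : LipschitzOnWith K φ t) : LocHolderAt α (fun y => φ (u y)) x := by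
  have hc := hu.continuousAt hα
  obtain ⟨C, s, hs, h⟩ := hu
  refine ⟨K * C, s ∩ u ⁻¹' t, Filter.inter_mem hs (hc ht), ?_⟩
  rintro y ⟨hy, hy'⟩ z ⟨hz, hz'⟩
  refine (hφ hy' hz').trans ?_
  push_cast
  rw [mul_assoc]
  gcongr
  exact h y hy z hz

theorem comp_lipschitz {v : Y → F} {k : X → Y} (hv : LocHolderAt α v (k x)) {K : ℝ≥0} {t : Set X}
    (ht : t ∈ 𝓝 x) (hk : LipschitzOnWith K k t) : LocHolderAt α (fun y => v (k y)) x := by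
  obtain ⟨C, s, hs, h⟩ := hv
  refine ⟨C * K ^ (α : ℝ), t ∩ k ⁻¹' s,
    Filter.inter_mem ht (hk.continuousOn.continuousAt ht hs), ?_⟩
  rintro y ⟨hy, hy'⟩ z ⟨hz, hz'⟩
  refine (h _ hy' _ hz').trans ?_
  rw [ENNReal.coe_mul, mul_assoc, ENNReal.coe_rpow_of_nonneg _ α.coe_nonneg,
    ← ENNReal.mul_rpow_of_nonneg _ _ α.coe_nonneg]
  gcongr
  exact hk hy hz

theorem of_lipschitzOnWith (hα' : α ≤ 1) {K : ℝ≥0} {t : Set X} (ht : t ∈ 𝓝 x)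
    (hu : LipschitzOnWith K u t) : LocHolderAt α u x := by
  -- In a ball of radius `1 / 2` distances are at most `1`, so `α ≤ 1` makes them at most their
  -- `α`-th powers.
  refine ⟨K, t ∩ ball x (1 / 2), Filter.inter_mem ht (ball_mem_nhds _ (by norm_num)), ?_⟩
  rintro y ⟨hy, hy'⟩ z ⟨hz, hz'⟩
  refine (hu hy hz).trans ?_
  gcongr
  have h1 : edist y z ≤ 1 := by
    rw [edist_dist, ← ENNReal.ofReal_one]
    apply ENNReal.ofReal_le_ofReal
    rw [mem_ball] at hy' hz'
    linarith [dist_triangle_right y z x]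
  calc edist y z = edist y z ^ (1 : ℝ) := (ENNReal.rpow_one _).symm
    _ ≤ edist y z ^ (α : ℝ) := ENNReal.rpow_le_rpow_of_exponent_ge h1 (by exact_mod_cast hα')

theorem contDiffAt_comp {F G : Type*} [NormedAddCommGroup F] [NormedSpace ℝ F]
    [NormedAddCommGroup G] [NormedSpace ℝ G] {u : X → F} (hα : 0 < α) (hu : LocHolderAt α u x)
    {φ : F → G} (hφ : ContDiffAt ℝ 1 φ (u x)) : LocHolderAt α (fun y => φ (u y)) x := by
  obtain ⟨K, t, ht, h⟩ := hφ.exists_lipschitzOnWith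
  exact hu.lipschitz_comp hα ht h

theorem add {u v : X → ℝ} (hα : 0 < α) (hu : LocHolderAt α u x) (hv : LocHolderAt α v x) :
    LocHolderAt α (fun y => u y + v y) x :=
  (hu.prodMk hv).contDiffAt_comp hα (φ := fun p : ℝ × ℝ => p.1 + p.2) (by fun_prop)

theorem contDiffAt_comp₂ {F F' G : Type*} [NormedAddCommGroup F] [NormedSpace ℝ F]
    [NormedAddCommGroup F'] [NormedSpace ℝ F'] [NormedAddCommGroup G] [NormedSpace ℝ G]
    {u : X → F} {v : X → F'} (hα : 0 < α) (hu : LocHolderAt α u x) (hv : LocHolderAt α v x)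
    {φ : F × F' → G} (hφ : ContDiffAt ℝ 1 φ (u x, v x)) :
    LocHolderAt α (fun y => φ (u y, v y)) x :=
  (hu.prodMk hv).contDiffAt_comp hα hφ

theorem clm_apply₂ {E F : Type*} [NormedAddCommGroup E] [NormedSpace ℝ E]
    [NormedAddCommGroup F] [NormedSpace ℝ F]
    {A : X → E →L[ℝ] F} {ξ : X → E} (hα : 0 < α) (hA : LocHolderAt α A x)
    (hξ : LocHolderAt α ξ x) : LocHolderAt α (fun y => A y (ξ y)) x :=
  hA.contDiffAt_comp₂ hα hξ (φ := fun p : (E →L[ℝ] F) × E => p.1 p.2)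
    (contDiffAt_fst.clm_apply contDiffAt_snd)

theorem bilin_apply {E : Type*} [NormedAddCommGroup E] [NormedSpace ℝ E]
    {A : X → E →L[ℝ] E →L[ℝ] ℝ} {ξ : X → E} (hα : 0 < α) (hA : LocHolderAt α A x)
    (hξ : LocHolderAt α ξ x) : LocHolderAt α (fun y => A y (ξ y) (ξ y)) x :=
  (hA.clm_apply₂ hα hξ).clm_apply₂ hα hξ

theorem clm_apply {E : Type*} [NormedAddCommGroup E] [NormedSpace ℝ E]
    {A : X → E →L[ℝ] E} (hα : 0 < α) (hA : LocHolderAt α A x) (v : E) :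
    LocHolderAt α (fun y => A y v) x :=
  hA.contDiffAt_comp hα (φ := fun A : E →L[ℝ] E => A v) (by fun_prop)

theorem const (v : F) : LocHolderAt α (fun _ : X => v) x :=
  ⟨0, Set.univ, Filter.univ_mem, fun y _ z _ => by simp⟩

/-- A locally Hölder continuous function on a compact space is Hölder continuous. -/
theorem exists_forall_dist_le {X : Type*} [MetricSpace X] [CompactSpace X]
    {u : X → ℝ} (hα : 0 < α) (hu : ∀ x, LocHolderAt α u x) :
    ∃ C : ℝ, 0 ≤ C ∧ ∀ x y, |u x - u y| ≤ C * dist x y ^ (α : ℝ) := by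
  have hcont : Continuous u := continuous_iff_continuousAt.2 fun x => (hu x).continuousAt hα
  have key : ∃ C : ℝ, 0 ≤ C ∧ ∀ p ∈ (Set.univ : Set (X × X)),
      |u p.1 - u p.2| ≤ C * dist p.1 p.2 ^ (α : ℝ) := by
    -- Compactness of `X × X`: near the diagonal the local Hölder bound applies. Away from it the
    -- distance is bounded below, so local boundedness of the difference suffices.
    refine isCompact_univ.induction_on
      (p := fun s : Set (X × X) => ∃ C : ℝ, 0 ≤ C ∧ ∀ p ∈ s,
        |u p.1 - u p.2| ≤ C * dist p.1 p.2 ^ (α : ℝ)) ⟨0, le_rfl, by simp⟩ ?_ ?_ ?_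
    · rintro s t hst ⟨C, hC, h⟩
      exact ⟨C, hC, fun p hp => h p (hst hp)⟩
    · rintro s t ⟨C, hC, h⟩ ⟨C', hC', h'⟩
      refine ⟨max C C', le_max_of_le_left hC, ?_⟩
      rintro p (hp | hp)
      · exact (h p hp).trans (by gcongr; exact le_max_left _ _)
      · exact (h' p hp).trans (by gcongr; exact le_max_right _ _)
    · rintro ⟨x, y⟩ -
      simp only [nhdsWithin_univ]
      by_cases hxy : x = y
      · subst hxy
        obtain ⟨C, s, hs, h⟩ := hu x
        refine ⟨s ×ˢ s, prod_mem_nhds hs hs, C, C.2, ?_⟩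
        rintro ⟨y, z⟩ ⟨hy, hz⟩
        have := h.dist_le hy hz
        rwa [Real.dist_eq] at this
      · have hpos : 0 < dist x y := dist_pos.2 hxy
        have h1 : ∀ᶠ p : X × X in 𝓝 (x, y), dist x y / 2 < dist p.1 p.2 :=
          (continuous_dist.tendsto (x, y)).eventually (lt_mem_nhds (half_lt_self hpos))
        have h2 : ∀ᶠ p : X × X in 𝓝 (x, y), |u p.1 - u p.2| < |u x - u y| + 1 := by
          have h3 : Continuous fun p : X × X => |u p.1 - u p.2| := by fun_prop
          exact (h3.tendsto (x, y)).eventually (gt_mem_nhds (lt_add_one _))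
        refine ⟨_, h1.and h2, (|u x - u y| + 1) / (dist x y / 2) ^ (α : ℝ), by positivity, ?_⟩
        rintro p ⟨hp1, hp2⟩
        refine hp2.le.trans ?_
        have h4 : (dist x y / 2) ^ (α : ℝ) ≤ dist p.1 p.2 ^ (α : ℝ) :=
          Real.rpow_le_rpow (by positivity) hp1.le α.2
        rw [div_mul_eq_mul_div, le_div_iff₀ (by positivity)]
        gcongr
  obtain ⟨C, hC, h⟩ := key
  exact ⟨C, hC, fun x y => h (x, y) (mem_univ _)⟩

end LocHolderAt

theorem exists_metric_in_trivialization {EB HB B F : Type*} [NormedAddCommGroup EB]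
    [NormedSpace ℝ EB] [TopologicalSpace HB] {IB : ModelWithCorners ℝ EB HB} {n : ℕ∞ω}
    [TopologicalSpace B] [ChartedSpace HB B] [NormedAddCommGroup F] [NormedSpace ℝ F]
    {E : B → Type*} [TopologicalSpace (TotalSpace F E)] [∀ x, NormedAddCommGroup (E x)]
    [∀ x, InnerProductSpace ℝ (E x)] [FiberBundle F E] [VectorBundle ℝ F E]
    [IsContMDiffRiemannianBundle IB n F E] (x : B) :
    ∃ G : B → F →L[ℝ] F →L[ℝ] ℝ, ContMDiffAt IB 𝓘(ℝ, F →L[ℝ] F →L[ℝ] ℝ) n G x ∧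
      ∀ y ∈ (trivializationAt F E x).baseSet, ∀ w : E y,
        ‖w‖ ^ 2 = G y ((trivializationAt F E x).continuousLinearMapAt ℝ y w)
          ((trivializationAt F E x).continuousLinearMapAt ℝ y w) := by
  obtain ⟨G, hG, h⟩ := IsContMDiffRiemannianBundle.exists_contMDiff (IB := IB) (n := n)
      (F := F) (E := E)
  have hGx := hG x
  rw [contMDiffAt_section] at hGx
  simp only [hom_trivializationAt_apply] at hGx
  refine ⟨_, hGx, fun y hyb w => ?_⟩
  rw [inCoordinates_apply_eq₂ hyb hyb (Set.mem_univ _), ← real_inner_self_eq_norm_sq, h]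
  have A : (trivializationAt F E x).symm y ((trivializationAt F E x).linearMapAt ℝ y w) = w := by
    convert! ((trivializationAt F E x).continuousLinearEquivAt ℝ _ hyb).symm_apply_apply w
    simp [Trivialization.coe_continuousLinearEquivAt_eq _ hyb]
  simp [A]

end LocHolder

/-! ### Conformal factors in charts -/

section ScalHolder

variable {d : ℕ} {M : Type*} [MetricSpace M] [ChartedSpace (EuclideanSpace ℝ (Fin d)) M]
  [IsManifold (𝓡 d) ∞ M] [RiemannianBundle (fun x : M => TangentSpace (𝓡 d) x)]
  [IsContMDiffRiemannianBundle (𝓡 d) ∞ (EuclideanSpace ℝ (Fin d))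
    (fun x : M => TangentSpace (𝓡 d) x)]

/-- The tangent bundle trivialization at `x` is the derivative of the chart, so this is the smooth
metric read in that trivialization. -/
theorem exists_metric_in_chart (d : ℕ) {M : Type*} [MetricSpace M]
    [ChartedSpace (EuclideanSpace ℝ (Fin d)) M]
    [IsManifold (𝓡 d) ∞ M] [RiemannianBundle (fun x : M => TangentSpace (𝓡 d) x)]
    [IsContMDiffRiemannianBundle (𝓡 d) ∞ (EuclideanSpace ℝ (Fin d))
      (fun x : M => TangentSpace (𝓡 d) x)] (x : M) :
    ∃ G : M → EuclideanSpace ℝ (Fin d) →L[ℝ] EuclideanSpace ℝ (Fin d) →L[ℝ] ℝ,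
      ContMDiffAt (𝓡 d) 𝓘(ℝ, EuclideanSpace ℝ (Fin d) →L[ℝ] EuclideanSpace ℝ (Fin d) →L[ℝ] ℝ)
        1 G x ∧
      ∀ y ∈ (extChartAt (𝓡 d) x).source, ∀ w : TangentSpace (𝓡 d) y,
        ‖w‖ ^ 2 = G y
          (mfderiv (𝓡 d) 𝓘(ℝ, EuclideanSpace ℝ (Fin d)) (extChartAt (𝓡 d) x) y w)
          (mfderiv (𝓡 d) 𝓘(ℝ, EuclideanSpace ℝ (Fin d)) (extChartAt (𝓡 d) x) y w) := by
  obtain ⟨G, hG, h⟩ := exists_metric_in_trivialization (IB := 𝓡 d) (n := ∞)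
    (F := EuclideanSpace ℝ (Fin d)) (E := fun x : M => TangentSpace (𝓡 d) x) x
  refine ⟨G, hG.of_le (m := 1) (by exact_mod_cast le_top), fun y hy w => ?_⟩
  have hy' : y ∈ (chartAt (EuclideanSpace ℝ (Fin d)) x).source := by rwa [extChartAt_source] at hy
  rw [← TangentBundle.continuousLinearMapAt_trivializationAt hy']
  exact h y hy' w

theorem locHolderAt_of_contMDiffAt [IsRiemannianManifold (𝓡 d) M] {F : Type*}
    [NormedAddCommGroup F] [NormedSpace ℝ F] {α : ℝ≥0}
    (hα : 0 < α) (hα' : α ≤ 1) {u : M → F} {x : M} (hu : ContMDiffAt (𝓡 d) 𝓘(ℝ, F) 1 u x) :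
    LocHolderAt α u x := by
  obtain ⟨C, ρ, hρ, hsrc, hlip⟩ := exists_extChartAt_lipschitz d x
  have h1 : ContDiffAt ℝ 1 (u ∘ (extChartAt (𝓡 d) x).symm) (extChartAt (𝓡 d) x x) := by
    have := (contMDiffAt_iff.1 hu).2
    rw [ModelWithCorners.range_eq_univ, contDiffWithinAt_univ] at this
    exact this
  refine ((LocHolderAt.of_lipschitzOnWith hα' (ball_mem_nhds x hρ) hlip).contDiffAt_comp hα
    h1).congr ?_
  filter_upwards [ball_mem_nhds x hρ] with y hy
  simp only [Function.comp_apply]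
  rw [(extChartAt (𝓡 d) x).left_inv (hsrc hy)]

/-- The chain rule applied to both sides of `chart ∘ g = F ∘ chart`, valid near `y`, where `F` is
`g` written in charts. -/
theorem mfderiv_extChartAt_mfderiv {g : M → M} (hg : IsConformalLocalDiffeo d g) {x y : M}
    (hy : y ∈ (extChartAt (𝓡 d) x).source) (hgy : g y ∈ (extChartAt (𝓡 d) (g x)).source)
    (w : TangentSpace (𝓡 d) y) :
    mfderiv (𝓡 d) 𝓘(ℝ, EuclideanSpace ℝ (Fin d)) (extChartAt (𝓡 d) (g x)) (g y)
        (mfderiv (𝓡 d) (𝓡 d) g y w) =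
      fderiv ℝ (writtenInExtChartAt (𝓡 d) (𝓡 d) x g) (extChartAt (𝓡 d) x y)
        (mfderiv (𝓡 d) 𝓘(ℝ, EuclideanSpace ℝ (Fin d)) (extChartAt (𝓡 d) x) y w) := by
  set F := writtenInExtChartAt (𝓡 d) (𝓡 d) x g with hF
  have hyc : y ∈ (chartAt (EuclideanSpace ℝ (Fin d)) x).source := by
    rwa [extChartAt_source] at hy
  have hgyc : g y ∈ (chartAt (EuclideanSpace ℝ (Fin d)) (g x)).source := by
    rwa [extChartAt_source] at hgy
  have hed := mdifferentiableAt_extChartAt (I := 𝓡 d) hyc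
  have h4 : mfderiv (𝓡 d) 𝓘(ℝ, EuclideanSpace ℝ (Fin d)) (extChartAt (𝓡 d) (g x) ∘ g) y =
      (mfderiv (𝓡 d) 𝓘(ℝ, EuclideanSpace ℝ (Fin d)) (extChartAt (𝓡 d) (g x)) (g y)) ∘L
        mfderiv (𝓡 d) (𝓡 d) g y :=
    mfderiv_comp y (mdifferentiableAt_extChartAt (I := 𝓡 d) hgyc) (hg.mdifferentiableAt y)
  have h5 : extChartAt (𝓡 d) (g x) ∘ g =ᶠ[𝓝 y] F ∘ extChartAt (𝓡 d) x := by
    filter_upwards [(isOpen_extChartAt_source (I := 𝓡 d) x).mem_nhds hy] with z hz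
    simp only [hF, writtenInExtChartAt, Function.comp_apply]
    rw [(extChartAt (𝓡 d) x).left_inv hz]
  have hback := (extChartAt (𝓡 d) x).left_inv hy
  have hFd : MDifferentiableAt 𝓘(ℝ, EuclideanSpace ℝ (Fin d))
      𝓘(ℝ, EuclideanSpace ℝ (Fin d)) F (extChartAt (𝓡 d) x y) := by
    have hsymm := mdifferentiableWithinAt_extChartAt_symm (I := 𝓡 d)
      ((extChartAt (𝓡 d) x).map_source hy)
    rw [ModelWithCorners.range_eq_univ, mdifferentiableWithinAt_univ] at hsymm
    have h1 : MDifferentiableAt 𝓘(ℝ, EuclideanSpace ℝ (Fin d)) (𝓡 d)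
        (g ∘ (extChartAt (𝓡 d) x).symm) (extChartAt (𝓡 d) x y) :=
      (hg.mdifferentiableAt _).comp _ hsymm
    have h2 : MDifferentiableAt (𝓡 d) 𝓘(ℝ, EuclideanSpace ℝ (Fin d)) (extChartAt (𝓡 d) (g x))
        ((g ∘ (extChartAt (𝓡 d) x).symm) (extChartAt (𝓡 d) x y)) := by
      apply mdifferentiableAt_extChartAt (I := 𝓡 d)
      simp only [Function.comp_apply]
      rwa [hback]
    exact h2.comp _ h1
  have h6 : mfderiv (𝓡 d) 𝓘(ℝ, EuclideanSpace ℝ (Fin d)) (F ∘ extChartAt (𝓡 d) x) y =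
      (mfderiv 𝓘(ℝ, EuclideanSpace ℝ (Fin d)) 𝓘(ℝ, EuclideanSpace ℝ (Fin d)) F
        (extChartAt (𝓡 d) x y)) ∘L
        mfderiv (𝓡 d) 𝓘(ℝ, EuclideanSpace ℝ (Fin d)) (extChartAt (𝓡 d) x) y :=
    mfderiv_comp y hFd hed
  have h7 : (mfderiv (𝓡 d) 𝓘(ℝ, EuclideanSpace ℝ (Fin d)) (extChartAt (𝓡 d) (g x) ∘ g) y :
      EuclideanSpace ℝ (Fin d) →L[ℝ] EuclideanSpace ℝ (Fin d)) w =
      (mfderiv (𝓡 d) 𝓘(ℝ, EuclideanSpace ℝ (Fin d)) (F ∘ extChartAt (𝓡 d) x) y :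
      EuclideanSpace ℝ (Fin d) →L[ℝ] EuclideanSpace ℝ (Fin d)) w :=
    congrArg (fun A : EuclideanSpace ℝ (Fin d) →L[ℝ] EuclideanSpace ℝ (Fin d) => A w)
      h5.mfderiv_eq
  rw [h4, h6, mfderiv_eq_fderiv] at h7
  exact h7

/-- In charts, `‖Dg‖² = G'(DF v, DF v) / G(v, v)`. -/
theorem scal_sq_mul_eq [NeZero d] {g : M → M} (hg : IsConformalLocalDiffeo d g)
    {x y : M} (hy : y ∈ (extChartAt (𝓡 d) x).source)
    (hgy : g y ∈ (extChartAt (𝓡 d) (g x)).source)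
    {G G' : M → EuclideanSpace ℝ (Fin d) →L[ℝ] EuclideanSpace ℝ (Fin d) →L[ℝ] ℝ}
    (hGn : ∀ w : TangentSpace (𝓡 d) y,
        ‖w‖ ^ 2 = G y
          (mfderiv (𝓡 d) 𝓘(ℝ, EuclideanSpace ℝ (Fin d)) (extChartAt (𝓡 d) x) y w)
          (mfderiv (𝓡 d) 𝓘(ℝ, EuclideanSpace ℝ (Fin d)) (extChartAt (𝓡 d) x) y w))
    (hGn' : ∀ w : TangentSpace (𝓡 d) (g y),
        ‖w‖ ^ 2 = G' (g y)
          (mfderiv (𝓡 d) 𝓘(ℝ, EuclideanSpace ℝ (Fin d)) (extChartAt (𝓡 d) (g x)) (g y) w)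
          (mfderiv (𝓡 d) 𝓘(ℝ, EuclideanSpace ℝ (Fin d)) (extChartAt (𝓡 d) (g x)) (g y) w))
    {v : EuclideanSpace ℝ (Fin d)} (hv : v ≠ 0) :
    0 < G y v v ∧ G' (g y)
      (fderiv ℝ (writtenInExtChartAt (𝓡 d) (𝓡 d) x g) (extChartAt (𝓡 d) x y) v)
      (fderiv ℝ (writtenInExtChartAt (𝓡 d) (𝓡 d) x g) (extChartAt (𝓡 d) x y) v) =
        scal d g y ^ 2 * G y v v := by
  have hyc : y ∈ (chartAt (EuclideanSpace ℝ (Fin d)) x).source := by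
    rwa [extChartAt_source] at hy
  obtain ⟨w, hw⟩ : ∃ w : TangentSpace (𝓡 d) y,
      mfderiv (𝓡 d) 𝓘(ℝ, EuclideanSpace ℝ (Fin d)) (extChartAt (𝓡 d) x) y w = v := by
    rw [← TangentBundle.continuousLinearMapAt_trivializationAt hyc]
    exact ⟨_, Trivialization.continuousLinearMapAt_symmL _ hyc v⟩
  have hw0 : w ≠ 0 := by
    rintro rfl
    rw [map_zero] at hw
    exact hv hw.symm
  have h1 := hGn w
  have h2 := hGn' (mfderiv (𝓡 d) (𝓡 d) g y w)
  rw [hg.norm_mfderiv_apply, mul_pow, mfderiv_extChartAt_mfderiv hg hy hgy, h1] at h2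
  have hw' : (mfderiv (𝓡 d) 𝓘(ℝ, EuclideanSpace ℝ (Fin d)) (extChartAt (𝓡 d) x) y :
      EuclideanSpace ℝ (Fin d) →L[ℝ] EuclideanSpace ℝ (Fin d)) w = v := hw
  constructor
  · have h3 : 0 < ‖w‖ ^ 2 := by positivity
    rw [h1, hw] at h3
    exact h3
  · have h3 := h2.symm
    rw [hw] at h3
    exact h3

set_option synthInstance.maxHeartbeats 200000 in
/-- The logarithm of the conformal factor of a conformal map of class `C^{1+α}` is locally
`α`-Hölder continuous. -/
theorem locHolderAt_log_scal [NeZero d] [IsRiemannianManifold (𝓡 d) M] {α : ℝ≥0}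
    (hα : 0 < α) (hα' : α ≤ 1) {g : M → M} (hg : IsConformalLocalDiffeo d g)
    (hgα : IsC1Holder d α g) (x : M) :
    LocHolderAt α (fun y => Real.log (scal d g y)) x := by
  -- By conformality a single coordinate direction `v`, the same for all `y`, determines the
  -- conformal factor.
  obtain ⟨v, hv⟩ := exists_ne (0 : EuclideanSpace ℝ (Fin d))
  obtain ⟨G, hG, hGn⟩ := exists_metric_in_chart d x
  obtain ⟨G', hG', hGn'⟩ := exists_metric_in_chart d (g x)
  obtain ⟨C, s, hs, hC⟩ := hgα.2 x
  obtain ⟨K, ρ, hρ, hsrc, hlip⟩ := exists_extChartAt_lipschitz d x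
  have hξ : LocHolderAt α (fun y => fderiv ℝ (writtenInExtChartAt (𝓡 d) (𝓡 d) x g)
      (extChartAt (𝓡 d) x y) v) x := by
    have h1 : LocHolderAt α (fderiv ℝ (writtenInExtChartAt (𝓡 d) (𝓡 d) x g))
      (extChartAt (𝓡 d) x x) := ⟨C, s, hs, hC⟩
    exact (h1.comp_lipschitz (ball_mem_nhds x hρ) hlip).clm_apply hα v
  have hG1 : LocHolderAt α (fun y => G y v v) x :=
    (locHolderAt_of_contMDiffAt hα hα' hG).bilin_apply hα (LocHolderAt.const v)
  have hG2 : LocHolderAt α (fun y => G' (g y)) x :=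
    locHolderAt_of_contMDiffAt hα hα' (hG'.comp x (hg.diffeo.contMDiff x))
  have hG3 := hG2.bilin_apply hα hξ
  have key : ∀ᶠ y in 𝓝 x, 0 < G y v v ∧ G' (g y)
      (fderiv ℝ (writtenInExtChartAt (𝓡 d) (𝓡 d) x g) (extChartAt (𝓡 d) x y) v)
      (fderiv ℝ (writtenInExtChartAt (𝓡 d) (𝓡 d) x g) (extChartAt (𝓡 d) x y) v) =
        scal d g y ^ 2 * G y v v := by
    have hcont : ∀ᶠ y in 𝓝 x, g y ∈ (extChartAt (𝓡 d) (g x)).source :=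
      hg.continuous.continuousAt (extChartAt_source_mem_nhds (I := 𝓡 d) (g x))
    filter_upwards [extChartAt_source_mem_nhds (I := 𝓡 d) x, hcont] with y hy hgy
    exact scal_sq_mul_eq hg hy hgy (hGn y hy) (hGn' _ hgy) hv
  have hpos := key.self_of_nhds
  have hpos' : 0 < scal d g x ^ 2 * G x v v := mul_pos (pow_pos (hg.scal_pos x) 2) hpos.1
  -- The logarithm of the factor is half the difference of the logarithms of `G'(DF v, DF v)` and
  -- `G(v, v)`. Both arguments are positive at `x`, where the logarithm is smooth.
  refine ((hG3.prodMk hG1).contDiffAt_comp hα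
    (φ := fun p : ℝ × ℝ => 2⁻¹ * (Real.log p.1 - Real.log p.2)) ?_).congr ?_
  · refine contDiffAt_const.mul (ContDiffAt.sub (contDiffAt_fst.log ?_) (contDiffAt_snd.log ?_))
    · rw [hpos.2]
      exact hpos'.ne'
    · exact hpos.1.ne'
  · filter_upwards [key] with y hy
    rw [hy.2, Real.log_mul (pow_pos (hg.scal_pos y) 2).ne' hy.1.ne', Real.log_pow]
    push_cast
    ring

end ScalHolder

/-! ### Hölder regularity along the semigroup -/

section SemigroupHolder

variable {d : ℕ} [NeZero d] {M : Type*} [MetricSpace M] [CompactSpace M]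
  [ChartedSpace (EuclideanSpace ℝ (Fin d)) M]
  [IsManifold (𝓡 d) ∞ M] [RiemannianBundle (fun x : M => TangentSpace (𝓡 d) x)]
  [IsRiemannianManifold (𝓡 d) M]

theorem exists_abs_log_scal_le {α : ℝ≥0} (hα : 0 < α) {h : M → M}
    (hα' : ∀ x, LocHolderAt α (fun y => Real.log (scal d h y)) x) :
    ∃ A : ℝ, ∀ x, |Real.log (scal d h x)| ≤ A := by
  have hcont : Continuous fun y => Real.log (scal d h y) :=
    continuous_iff_continuousAt.2 fun x => (hα' x).continuousAt hα
  obtain ⟨A, hA⟩ := isCompact_univ.exists_bound_of_continuousOn hcont.continuousOn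
  exact ⟨A, fun x => hA x (mem_univ x)⟩

theorem IsConformalLocalDiffeo.lipschitzWith {α : ℝ≥0} (hα : 0 < α) {h : M → M}
    (hh : IsConformalLocalDiffeo d h)
    (hα' : ∀ x, LocHolderAt α (fun y => Real.log (scal d h y)) x) :
    ∃ K : ℝ≥0, LipschitzWith K h := by
  obtain ⟨A, hA⟩ := exists_abs_log_scal_le hα hα'
  refine ⟨⟨Real.exp A, (Real.exp_pos A).le⟩, LipschitzWith.of_dist_le_mul fun x y => ?_⟩
  refine hh.dist_le_of_scal_le (Real.exp_pos A).le (fun x => ?_) x y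
  rw [← Real.log_le_iff_le_exp (hh.scal_pos x)]
  exact (le_abs_self _).trans (hA x)

/-- The logarithm of the conformal factor is an additive cocycle under composition, and precomposing
with a Lipschitz generator preserves local Hölder continuity. -/
theorem locHolderAt_log_scal_of_mem {α : ℝ≥0} (hα : 0 < α) {N : ℕ}
    {g : Fin N → M → M} (hg : ∀ i, IsConformalLocalDiffeo d (g i))
    (hgα : ∀ i x, LocHolderAt α (fun y => Real.log (scal d (g i) y)) x) {h : M → M}
    (hh : h ∈ generatedSemigroup g) (x : M) :
    LocHolderAt α (fun y => Real.log (scal d h y)) x := by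
  obtain ⟨w, rfl⟩ := hh
  induction w generalizing x with
  | nil =>
    have : (fun y : M => Real.log (scal d (wordMap g []) y)) = fun _ => 0 := by
      funext y
      rw [show wordMap g [] = (id : M → M) from rfl, scal_id, Real.log_one]
    rw [this]
    exact LocHolderAt.const 0
  | cons i w ih =>
    obtain ⟨K, hK⟩ := (hg i).lipschitzWith hα (hgα i)
    have hw : IsConformalLocalDiffeo d (wordMap g w) := isConformalLocalDiffeo_of_mem hg ⟨w, rfl⟩
    refine (LocHolderAt.add hα ((ih (g i x)).comp_lipschitz Filter.univ_mem
      hK.lipschitzOnWith) (hgα i x)).congr (Filter.Eventually.of_forall fun y => ?_)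
    change Real.log (scal d (wordMap g w ∘ g i) y) = _
    rw [hw.scal_comp (hg i), Real.log_mul (hw.scal_pos _).ne' ((hg i).scal_pos _).ne']

end SemigroupHolder

/-! ### Ahlfors regularity of the Riemannian volume -/

section Ahlfors

open Measure

theorem LipschitzOnWith.euclideanHausdorffMeasure_image_le {X Y : Type*} [MetricSpace X]
    [MeasurableSpace X] [BorelSpace X] [MetricSpace Y] [MeasurableSpace Y] [BorelSpace Y]
    {K : ℝ≥0} {f : X → Y} {s : Set X} (hf : LipschitzOnWith K f s) (d : ℕ) :
    euclideanHausdorffMeasure d (f '' s) ≤ (K : ℝ≥0∞) ^ d * euclideanHausdorffMeasure d s := by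
  have h := hf.hausdorffMeasure_image_le (d := d) (Nat.cast_nonneg d)
  rw [ENNReal.rpow_natCast] at h
  rw [euclideanHausdorffMeasure_def, euclideanHausdorffMeasure_def, Measure.smul_apply,
    Measure.smul_apply, mul_smul_comm]
  gcongr

variable {d : ℕ} {M : Type*} [MetricSpace M] [MeasurableSpace M] [BorelSpace M]
  [ChartedSpace (EuclideanSpace ℝ (Fin d)) M]
  [IsManifold (𝓡 d) ∞ M] [RiemannianBundle (fun x : M => TangentSpace (𝓡 d) x)]
  [IsContMDiffRiemannianBundle (𝓡 d) ∞ (EuclideanSpace ℝ (Fin d))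
    (fun x : M => TangentSpace (𝓡 d) x)]
  [IsRiemannianManifold (𝓡 d) M]

theorem euclideanHausdorffMeasure_ball_eq (x : EuclideanSpace ℝ (Fin d)) {r : ℝ} (hr : 0 < r) :
    euclideanHausdorffMeasure d (ball x r) =
      ENNReal.ofReal (r ^ d * (volume (ball (0 : EuclideanSpace ℝ (Fin d)) 1)).toReal) := by
  rw [EuclideanSpace.euclideanHausdorffMeasure_eq_volume, addHaar_ball_of_pos _ _ hr,
    finrank_euclideanSpace_fin, ENNReal.ofReal_mul (by positivity),
    ENNReal.ofReal_toReal measure_ball_lt_top.ne]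

theorem euclideanHausdorffMeasure_closedBall_eq (x : EuclideanSpace ℝ (Fin d)) {r : ℝ}
    (hr : 0 < r) :
    euclideanHausdorffMeasure d (closedBall x r) =
      ENNReal.ofReal (r ^ d * (volume (ball (0 : EuclideanSpace ℝ (Fin d)) 1)).toReal) := by
  rw [EuclideanSpace.euclideanHausdorffMeasure_eq_volume, addHaar_closedBall _ _ hr.le,
    finrank_euclideanSpace_fin, ENNReal.ofReal_mul (by positivity),
    ENNReal.ofReal_toReal measure_ball_lt_top.ne]

/-- Charts are locally bi-Lipschitz, and a `K`-Lipschitz map increases `d`-dimensional Hausdorff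
measure by at most `K ^ d`. So balls are compared with Euclidean balls. -/
theorem exists_ahlfors_nhds (d : ℕ) {M : Type*} [MetricSpace M] [MeasurableSpace M] [BorelSpace M]
    [ChartedSpace (EuclideanSpace ℝ (Fin d)) M]
    [IsManifold (𝓡 d) ∞ M] [RiemannianBundle (fun x : M => TangentSpace (𝓡 d) x)]
    [IsContMDiffRiemannianBundle (𝓡 d) ∞ (EuclideanSpace ℝ (Fin d))
      (fun x : M => TangentSpace (𝓡 d) x)]
    [IsRiemannianManifold (𝓡 d) M] (x₀ : M) :
    ∃ ρ > 0, ∃ c > 0, ∃ C > 0, ∀ x ∈ ball x₀ ρ, ∀ s, 0 < s → s ≤ ρ →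
      ENNReal.ofReal (c * s ^ d) ≤ euclideanHausdorffMeasure d (ball x s) ∧
      euclideanHausdorffMeasure d (closedBall x s) ≤ ENNReal.ofReal (C * s ^ d) := by
  obtain ⟨C₁, ρ₁, hρ₁, hsrc, hlip₁⟩ := exists_extChartAt_lipschitz d x₀
  obtain ⟨C₂, ρ₂, hρ₂, htgt, hlip₂⟩ := exists_extChartAt_symm_lipschitz d x₀
  set e := extChartAt (𝓡 d) x₀ with he
  set K : ℝ≥0 := max (max C₁ C₂) 1 with hK
  have hK1 : (1 : ℝ) ≤ K := by exact_mod_cast le_max_right _ _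
  have hK0 : (0 : ℝ) < K := by linarith
  have hl₁ : LipschitzOnWith K e (ball x₀ ρ₁) :=
    hlip₁.weaken ((le_max_left _ _).trans (le_max_left _ _))
  have hl₂ : LipschitzOnWith K e.symm (ball (e x₀) ρ₂) :=
    hlip₂.weaken ((le_max_right _ _).trans (le_max_left _ _))
  -- With this `ρ`, all balls considered lie within `2ρ` of `x₀`, inside the domain of the chart
  -- estimate, and their chart images stay where the inverse chart is Lipschitz.
  obtain ⟨ρ, hρ, hρa, hρb⟩ : ∃ ρ > 0, 2 * ρ < ρ₁ ∧ (K : ℝ) * (2 * ρ) < ρ₂ := by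
    refine ⟨min (ρ₁ / 4) (ρ₂ / (4 * K)), by positivity, ?_, ?_⟩
    · linarith [min_le_left (ρ₁ / 4) (ρ₂ / (4 * K))]
    · have h1 := min_le_right (ρ₁ / 4) (ρ₂ / (4 * K))
      calc (K : ℝ) * (2 * min (ρ₁ / 4) (ρ₂ / (4 * K))) ≤ K * (2 * (ρ₂ / (4 * K))) := by gcongr
        _ = ρ₂ / 2 := by field_simp; ring
        _ < ρ₂ := by linarith
  set V := (volume (ball (0 : EuclideanSpace ℝ (Fin d)) 1)).toReal with hV
  have hVpos : 0 < V := ENNReal.toReal_pos (measure_ball_pos _ _ one_pos).ne' measure_ball_lt_top.ne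
  refine ⟨ρ, hρ, (K : ℝ)⁻¹ ^ d * ((K : ℝ)⁻¹ ^ d * V), by positivity, K ^ d * (K ^ d * V),
    by positivity, fun x hx s hs hsρ => ?_⟩
  have hx₀ : x₀ ∈ ball x₀ ρ₁ := mem_ball_self hρ₁
  have hxρ : dist x x₀ < ρ := hx
  have hx₁ : x ∈ ball x₀ ρ₁ := by rw [mem_ball]; linarith
  constructor
  · have hKs : s / K ≤ ρ := (div_le_self hs.le hK1).trans hsρ
    have hsub : ball (e x) (s / K) ⊆ ball (e x₀) ρ₂ := by
      apply ball_subset_ball'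
      have h1 : dist (e x) (e x₀) ≤ K * dist x x₀ := hl₁.dist_le_mul x hx₁ x₀ hx₀
      have h2 : (K : ℝ) * dist x x₀ ≤ K * ρ := by gcongr
      have h3 : ρ ≤ K * ρ := le_mul_of_one_le_left hρ.le hK1
      linarith
    have hexm : e x ∈ ball (e x₀) ρ₂ := hsub (mem_ball_self (by positivity))
    have himg : e.symm '' ball (e x) (s / K) ⊆ ball x s := by
      rintro _ ⟨p, hp, rfl⟩
      have h1 := hl₂.dist_le_mul p (hsub hp) (e x) hexm
      rw [e.left_inv (hsrc hx₁)] at h1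
      rw [mem_ball] at hp ⊢
      refine h1.trans_lt ?_
      rwa [lt_div_iff₀' hK0] at hp
    have himg' : e.symm '' ball (e x) (s / K) ⊆ ball x₀ ρ₁ := by
      refine himg.trans (ball_subset_ball' ?_)
      linarith
    have heq : e '' (e.symm '' ball (e x) (s / K)) = ball (e x) (s / K) := by
      rw [image_image]
      refine (image_congr fun p hp => e.right_inv (htgt (hsub hp))).trans (image_id _)
    have h2 := (hl₁.mono himg').euclideanHausdorffMeasure_image_le d
    rw [heq, euclideanHausdorffMeasure_ball_eq _ (by positivity), ← hV] at h2
    have h3 := h2.trans (by gcongr : _ ≤ (K : ℝ≥0∞) ^ d * euclideanHausdorffMeasure d (ball x s))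
    calc ENNReal.ofReal ((K : ℝ)⁻¹ ^ d * ((K : ℝ)⁻¹ ^ d * V) * s ^ d)
        = ENNReal.ofReal ((K : ℝ)⁻¹ ^ d) * ENNReal.ofReal ((s / K) ^ d * V) := by
          rw [← ENNReal.ofReal_mul (by positivity)]
          congr 1
          rw [div_pow, inv_pow]
          field_simp
      _ ≤ ENNReal.ofReal ((K : ℝ)⁻¹ ^ d) *
          ((K : ℝ≥0∞) ^ d * euclideanHausdorffMeasure d (ball x s)) := by
          gcongr
      _ = euclideanHausdorffMeasure d (ball x s) := by
          have : ENNReal.ofReal ((K : ℝ)⁻¹ ^ d) * (K : ℝ≥0∞) ^ d = 1 := by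
            rw [← ENNReal.ofReal_coe_nnreal, ← ENNReal.ofReal_pow hK0.le,
              ← ENNReal.ofReal_mul (by positivity), ← mul_pow, inv_mul_cancel₀ hK0.ne', one_pow,
              ENNReal.ofReal_one]
          rw [← mul_assoc, this, one_mul]
  · have hsub : closedBall x s ⊆ ball x₀ ρ₁ := by
      refine (closedBall_subset_ball' ?_)
      linarith
    have hcov : closedBall x s ⊆ e.symm '' (closedBall (e x) (K * s) ∩ ball (e x₀) ρ₂) := by
      intro y hy
      refine ⟨e y, ⟨?_, ?_⟩, e.left_inv (hsrc (hsub hy))⟩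
      · rw [mem_closedBall] at hy ⊢
        exact (hl₁.dist_le_mul y (hsub hy) x hx₁).trans (by gcongr)
      · rw [mem_ball]
        refine (hl₁.dist_le_mul y (hsub hy) x₀ hx₀).trans_lt (lt_of_le_of_lt ?_ hρb)
        gcongr
        rw [mem_closedBall] at hy
        linarith [dist_triangle y x x₀]
    calc euclideanHausdorffMeasure d (closedBall x s)
        ≤ euclideanHausdorffMeasure d (e.symm '' (closedBall (e x) (K * s) ∩ ball (e x₀) ρ₂)) :=
          measure_mono hcov
      _ ≤ (K : ℝ≥0∞) ^ d *
          euclideanHausdorffMeasure d (closedBall (e x) (K * s) ∩ ball (e x₀) ρ₂) :=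
          (hl₂.mono inter_subset_right).euclideanHausdorffMeasure_image_le d
      _ ≤ (K : ℝ≥0∞) ^ d * euclideanHausdorffMeasure d (closedBall (e x) (K * s)) := by
          gcongr
          exact inter_subset_left
      _ = ENNReal.ofReal (K ^ d * (K ^ d * V) * s ^ d) := by
          rw [euclideanHausdorffMeasure_closedBall_eq _ (by positivity), ← hV,
            ← ENNReal.ofReal_coe_nnreal, ← ENNReal.ofReal_pow hK0.le,
            ← ENNReal.ofReal_mul (by positivity)]
          congr 1
          ring

theorem exists_ahlfors (d : ℕ) (M : Type*) [MetricSpace M] [CompactSpace M] [MeasurableSpace M]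
    [BorelSpace M] [ChartedSpace (EuclideanSpace ℝ (Fin d)) M]
    [IsManifold (𝓡 d) ∞ M] [RiemannianBundle (fun x : M => TangentSpace (𝓡 d) x)]
    [IsContMDiffRiemannianBundle (𝓡 d) ∞ (EuclideanSpace ℝ (Fin d))
      (fun x : M => TangentSpace (𝓡 d) x)]
    [IsRiemannianManifold (𝓡 d) M] :
    ∃ ρ > 0, ∃ c > 0, ∃ C > 0, ∀ x : M, ∀ s, 0 < s → s ≤ ρ →
      ENNReal.ofReal (c * s ^ d) ≤ euclideanHausdorffMeasure d (ball x s) ∧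
      euclideanHausdorffMeasure d (closedBall x s) ≤ ENNReal.ofReal (C * s ^ d) := by
  have key : ∃ ρ > 0, ∃ c > 0, ∃ C > 0, ∀ x ∈ (Set.univ : Set M), ∀ s, 0 < s → s ≤ ρ →
      ENNReal.ofReal (c * s ^ d) ≤ euclideanHausdorffMeasure d (ball x s) ∧
      euclideanHausdorffMeasure d (closedBall x s) ≤ ENNReal.ofReal (C * s ^ d) := by
    refine isCompact_univ.induction_on (p := fun t : Set M => ∃ ρ > 0, ∃ c > 0, ∃ C > 0,
      ∀ x ∈ t, ∀ s, 0 < s → s ≤ ρ →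
      ENNReal.ofReal (c * s ^ d) ≤ euclideanHausdorffMeasure d (ball x s) ∧
      euclideanHausdorffMeasure d (closedBall x s) ≤ ENNReal.ofReal (C * s ^ d))
      ⟨1, one_pos, 1, one_pos, 1, one_pos, by simp⟩ ?_ ?_ ?_
    · rintro s t hst ⟨ρ, hρ, c, hc, C, hC, h⟩
      exact ⟨ρ, hρ, c, hc, C, hC, fun x hx => h x (hst hx)⟩
    · rintro s t ⟨ρ, hρ, c, hc, C, hC, h⟩ ⟨ρ', hρ', c', hc', C', hC', h'⟩
      refine ⟨min ρ ρ', lt_min hρ hρ', min c c', lt_min hc hc', max C C', lt_max_of_lt_left hC,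
        ?_⟩
      rintro x (hx | hx) s hs hsρ
      · obtain ⟨h1, h2⟩ := h x hx s hs (hsρ.trans (min_le_left _ _))
        refine ⟨le_trans ?_ h1, h2.trans ?_⟩
        · gcongr
          exact min_le_left _ _
        · gcongr
          exact le_max_left _ _
      · obtain ⟨h1, h2⟩ := h' x hx s hs (hsρ.trans (min_le_right _ _))
        refine ⟨le_trans ?_ h1, h2.trans ?_⟩
        · gcongr
          exact min_le_right _ _
        · gcongr
          exact le_max_right _ _
    · intro x₀ _
      obtain ⟨ρ, hρ, c, hc, C, hC, h⟩ := exists_ahlfors_nhds d x₀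
      exact ⟨ball x₀ ρ, mem_nhdsWithin_of_mem_nhds (ball_mem_nhds _ hρ), ρ, hρ, c, hc, C, hC, h⟩
  obtain ⟨ρ, hρ, c, hc, C, hC, h⟩ := key
  exact ⟨ρ, hρ, c, hc, C, hC, fun x => h x (mem_univ x)⟩

end Ahlfors

/-! ### Admissible words and their cylinders -/

section Words

theorem invDerivNorm_nonneg {d : ℕ} {M : Type*} [MetricSpace M]
    [ChartedSpace (EuclideanSpace ℝ (Fin d)) M] [IsManifold (𝓡 d) ∞ M]
    [RiemannianBundle (fun x : M => TangentSpace (𝓡 d) x)] (h : M → M) (x : M) :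
    0 ≤ invDerivNorm d h x :=
  norm_nonneg (mfderiv (𝓡 d) (𝓡 d) h x).inverse

namespace ExpandingCover

variable {d : ℕ} {M : Type*} [MetricSpace M] [ChartedSpace (EuclideanSpace ℝ (Fin d)) M]
  [IsManifold (𝓡 d) ∞ M] [RiemannianBundle (fun x : M => TangentSpace (𝓡 d) x)]
  {N : ℕ} {g : Fin N → M → M} (D : ExpandingCover d g)

/-- `w` is an admissible word of `x`, the empty word being allowed. -/
def AdmissibleFrom (w : List (Fin D.k)) (x : M) : Prop :=
  ∀ (j : ℕ) (hj : j < w.length), wordMap D.f (w.take j) x ∈ D.V w[j]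

theorem admissibleFrom_cons {i : Fin D.k} {w : List (Fin D.k)} {x : M} :
    D.AdmissibleFrom (i :: w) x ↔ x ∈ D.V i ∧ D.AdmissibleFrom w (D.f i x) := by
  constructor
  · intro h
    exact ⟨h 0 (by simp), fun j hj => h (j + 1) (by simpa using hj)⟩
  · rintro ⟨h0, h⟩ j hj
    cases j with
    | zero => exact h0
    | succ j => exact h j (by simpa using hj)

theorem cylinder_nil (B : Set M) : D.cylinder [] B = B := by
  ext z
  simp [cylinder, wordMap]

theorem cylinder_cons (i : Fin D.k) (w : List (Fin D.k)) (B : Set M) :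
    D.cylinder (i :: w) B = thickening D.r (D.V i) ∩ D.f i ⁻¹' D.cylinder w B := by
  ext z
  constructor
  · rintro ⟨h, hB⟩
    exact ⟨h 0 (by simp), fun j hj => h (j + 1) (by simpa using hj), hB⟩
  · rintro ⟨h0, h, hB⟩
    refine ⟨fun j hj => ?_, hB⟩
    cases j with
    | zero => exact h0
    | succ j => exact h j (by simpa using hj)

theorem exists_mem_V (x : M) : ∃ i, x ∈ D.V i := by
  have : x ∈ ⋃ i, ball (D.center i) (D.radius i) := by rw [D.cover]; exact mem_univ x
  exact mem_iUnion.1 this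

theorem exists_admissibleFrom (n : ℕ) (x : M) :
    ∃ w : List (Fin D.k), w.length = n ∧ D.AdmissibleFrom w x := by
  induction n generalizing x with
  | zero => exact ⟨[], rfl, fun j hj => by simp at hj⟩
  | succ n ih =>
    obtain ⟨i, hi⟩ := D.exists_mem_V x
    obtain ⟨w, hw, hw'⟩ := ih (D.f i x)
    exact ⟨i :: w, by simp [hw], D.admissibleFrom_cons.2 ⟨hi, hw'⟩⟩

theorem self_subset_thickening_V (i : Fin D.k) : D.V i ⊆ thickening D.r (D.V i) :=
  self_subset_thickening D.r_pos _

theorem σ_pos [Nonempty M] : 0 < D.σ := by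
  obtain ⟨i, hi⟩ := D.exists_mem_V (Classical.arbitrary M)
  exact lt_of_le_of_lt (invDerivNorm_nonneg _ _) (D.expanding i _ (D.self_subset_thickening_V i hi))

theorem injOn_f (i : Fin D.k) : InjOn (D.f i) (thickening D.r (D.V i)) := by
  obtain ⟨Φ, hΦ, h⟩ := D.diffeo i
  rw [V, ← hΦ] at *
  exact (Φ.toPartialEquiv.injOn).congr h.symm

section

variable {D}

theorem isConformalLocalDiffeo_f (hg : ∀ i, IsConformalLocalDiffeo d (g i))
    (i : Fin D.k) : IsConformalLocalDiffeo d (D.f i) :=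
  isConformalLocalDiffeo_of_mem hg (D.f_mem i)

theorem isConformalLocalDiffeo_wordMap (hg : ∀ i, IsConformalLocalDiffeo d (g i))
    (w : List (Fin D.k)) :
    IsConformalLocalDiffeo d (wordMap D.f w) :=
  isConformalLocalDiffeo_of_mem hg (wordMap_mem_generatedSemigroup D.f_mem w)

variable [NeZero d]

theorem inv_σ_lt_scal_f [Nonempty M]
    (hg : ∀ i, IsConformalLocalDiffeo d (g i)) {i : Fin D.k} {x : M}
    (hx : x ∈ thickening D.r (D.V i)) :
    D.σ⁻¹ < scal d (D.f i) x := by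
  have h := D.expanding i x hx
  rw [(isConformalLocalDiffeo_f hg i).invDerivNorm_eq] at h
  exact inv_lt_of_inv_lt₀ ((isConformalLocalDiffeo_f hg i).scal_pos x) h

variable [IsRiemannianManifold (𝓡 d) M]

theorem exists_preimage_f [ProperSpace M] [Nonempty M]
    (hg : ∀ i, IsConformalLocalDiffeo d (g i)) {i : Fin D.k} {x y : M} (hx : x ∈ D.V i)
    (hy : dist (D.f i x) y < D.r) :
    ∃ z ∈ thickening D.r (D.V i), D.f i z = y ∧ dist x z ≤ D.σ * dist (D.f i x) y := by
  have hσ := D.σ_pos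
  -- A radius strictly below `r` is needed for a closed ball to fit in the open `r`-neighbourhood.
  obtain ⟨ρ, hρ, hρr⟩ := exists_between hy
  have h1 : closedBall x ρ ⊆ thickening D.r (D.V i) := fun z hz =>
    mem_thickening_iff.2 ⟨x, hx, (mem_closedBall.1 hz).trans_lt hρr⟩
  obtain ⟨z, hz, hfz, hd⟩ := (isConformalLocalDiffeo_f hg i).exists_preimage
    isOpen_thickening (D.injOn_f i) (inv_pos.2 hσ) (fun x hx => (inv_σ_lt_scal_f hg hx).le)
    (D.self_subset_thickening_V i hx) h1 (y := y) (by
      refine hρ.trans_le (le_mul_of_one_le_left (dist_nonneg.trans hρ.le) ?_)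
      exact (one_le_inv₀ hσ).2 D.σ_lt_one.le)
  refine ⟨z, hz, hfz, ?_⟩
  rwa [inv_mul_le_iff₀ hσ] at hd

/-- The ball is pulled back one letter at a time. Each inverse branch contracts by `σ`, so the
pulled-back set stays within `ε < r` of the orbit of `x`, and the next branch is defined on all of
it. -/
theorem cylinder_ball [ProperSpace M] [Nonempty M]
    (hg : ∀ i, IsConformalLocalDiffeo d (g i)) {ε : ℝ} (hε : 0 < ε) (hεr : ε < D.r)
    {w : List (Fin D.k)} {x : M} (hw : D.AdmissibleFrom w x) :
    IsOpen (D.cylinder w (ball (wordMap D.f w x) ε)) ∧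
    x ∈ D.cylinder w (ball (wordMap D.f w x) ε) ∧
    InjOn (wordMap D.f w) (D.cylinder w (ball (wordMap D.f w x) ε)) ∧
    wordMap D.f w '' D.cylinder w (ball (wordMap D.f w x) ε) = ball (wordMap D.f w x) ε ∧
    ∀ z ∈ D.cylinder w (ball (wordMap D.f w x) ε),
      dist x z ≤ D.σ ^ w.length * dist (wordMap D.f w x) (wordMap D.f w z) ∧
      D.σ⁻¹ ^ w.length ≤ scal d (wordMap D.f w) z := by
  have hσ := D.σ_pos
  induction w generalizing x with
  | nil =>
    rw [cylinder_nil]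
    refine ⟨isOpen_ball, mem_ball_self hε, fun y _ z _ h => h, image_id _, fun z hz => ?_⟩
    rw [show wordMap D.f [] = (id : M → M) from rfl, scal_id]
    simp
  | cons i w ih =>
    obtain ⟨hx, hw'⟩ := D.admissibleFrom_cons.1 hw
    obtain ⟨h1, h2, h3, h4, h5⟩ := ih hw'
    have hfi := isConformalLocalDiffeo_f hg i
    have hfw := isConformalLocalDiffeo_wordMap (D := D) hg w
    rw [cylinder_cons]
    change IsOpen (thickening D.r (D.V i) ∩
      D.f i ⁻¹' D.cylinder w (ball (wordMap D.f w (D.f i x)) ε)) ∧ _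
    set S' := D.cylinder w (ball (wordMap D.f w (D.f i x)) ε) with hS'
    have hmem : ∀ z' ∈ S', dist (D.f i x) z' < ε := by
      intro z' hz'
      refine (h5 z' hz').1.trans_lt ?_
      have hb : dist (wordMap D.f w (D.f i x)) (wordMap D.f w z') < ε := by
        rw [← mem_ball', ← h4]
        exact mem_image_of_mem _ hz'
      exact (mul_le_of_le_one_left dist_nonneg
        (pow_le_one₀ hσ.le D.σ_lt_one.le)).trans_lt hb
    refine ⟨isOpen_thickening.inter (h1.preimage hfi.continuous),
      ⟨D.self_subset_thickening_V i hx, h2⟩, ?_, ?_, ?_⟩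
    · rintro y ⟨hy, hy'⟩ z ⟨hz, hz'⟩ hyz
      exact D.injOn_f i hy hz (h3 hy' hz' hyz)
    · apply Subset.antisymm
      · rintro _ ⟨z, ⟨hz, hz'⟩, rfl⟩
        change wordMap D.f w (D.f i z) ∈ ball (wordMap D.f w (D.f i x)) ε
        rw [← h4]
        exact mem_image_of_mem _ hz'
      · intro y hy
        change y ∈ ball (wordMap D.f w (D.f i x)) ε at hy
        rw [← h4] at hy
        obtain ⟨z', hz', rfl⟩ := hy
        obtain ⟨z, hz, rfl, -⟩ := exists_preimage_f hg hx ((hmem z' hz').trans hεr)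
        exact ⟨z, ⟨hz, hz'⟩, rfl⟩
    · rintro z ⟨hz, hz'⟩
      obtain ⟨z₂, hz₂, hfz, hd⟩ := exists_preimage_f hg hx ((hmem _ hz').trans hεr)
      obtain rfl := D.injOn_f i hz₂ hz hfz
      obtain ⟨h6, h7⟩ := h5 _ hz'
      constructor
      · rw [List.length_cons, pow_succ', mul_assoc]
        exact hd.trans (by gcongr; exact h6)
      · change _ ≤ scal d (wordMap D.f w ∘ D.f i) z₂
        rw [hfw.scal_comp hfi, List.length_cons, pow_succ]
        have := (inv_σ_lt_scal_f hg hz).le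
        have := (hfw.scal_pos (D.f i z₂)).le
        gcongr

/-- The variations of the logarithms along the orbit are dominated by a geometric series of ratio `σ
^ α`. The bound is kept as its partial sum so that the induction closes; it is at most a constant
independent of the word. -/
theorem abs_log_scal_wordMap_sub_le [ProperSpace M] [Nonempty M]
    (hg : ∀ i, IsConformalLocalDiffeo d (g i)) {α : ℝ} (hα : 0 < α)
    {C : ℝ} (hC : 0 ≤ C)
    (hfC : ∀ i x y, |Real.log (scal d (D.f i) x) - Real.log (scal d (D.f i) y)| ≤
      C * dist x y ^ α) {ε : ℝ} (hε : 0 < ε) (hεr : ε < D.r)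
    {w : List (Fin D.k)} {x : M} (hw : D.AdmissibleFrom w x) :
    ∀ z ∈ D.cylinder w (ball (wordMap D.f w x) ε),
      |Real.log (scal d (wordMap D.f w) x) - Real.log (scal d (wordMap D.f w) z)| ≤
        C * ε ^ α / (1 - D.σ ^ α) * (1 - (D.σ ^ α) ^ w.length) := by
  have hσ := D.σ_pos
  have hq : D.σ ^ α < 1 := Real.rpow_lt_one hσ.le D.σ_lt_one hα
  have hq0 : 0 < D.σ ^ α := Real.rpow_pos_of_pos hσ α
  induction w generalizing x with
  | nil =>
    intro z _
    rw [show wordMap D.f [] = (id : M → M) from rfl, scal_id, scal_id]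
    simp
  | cons i w ih =>
    intro z hz
    obtain ⟨h1, h2, h3, h4, h5⟩ := cylinder_ball hg hε hεr hw
    have hzd := (h5 z hz).1
    have hzb : dist (wordMap D.f (i :: w) x) (wordMap D.f (i :: w) z) < ε := by
      rw [← mem_ball', ← h4]
      exact mem_image_of_mem _ hz
    obtain ⟨hx, hw'⟩ := D.admissibleFrom_cons.1 hw
    rw [cylinder_cons] at hz
    have hfi := isConformalLocalDiffeo_f hg i
    have hfw := isConformalLocalDiffeo_wordMap (D := D) hg w
    have h6 := ih hw' _ hz.2
    have h7 := hfC i x z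
    -- The whole word gives contraction `σ ^ (w.length + 1)`; one factor is dropped to match the
    -- increment of the geometric sum.
    have h8 : C * dist x z ^ α ≤ C * ε ^ α * (D.σ ^ α) ^ w.length := by
      rw [mul_assoc]
      gcongr
      have h9 : dist x z ≤ ε * D.σ ^ w.length := by
        refine hzd.trans ?_
        rw [mul_comm]
        exact mul_le_mul hzb.le (pow_le_pow_of_le_one hσ.le D.σ_lt_one.le (Nat.le_succ _))
          (by positivity) hε.le
      refine (Real.rpow_le_rpow dist_nonneg h9 hα.le).trans_eq ?_
      rw [Real.mul_rpow hε.le (by positivity), ← Real.rpow_natCast, ← Real.rpow_natCast,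
        ← Real.rpow_mul hσ.le, ← Real.rpow_mul hσ.le, mul_comm α]
    change |Real.log (scal d (wordMap D.f w ∘ D.f i) x) -
      Real.log (scal d (wordMap D.f w ∘ D.f i) z)| ≤ _
    rw [hfw.scal_comp hfi, hfw.scal_comp hfi,
      Real.log_mul (hfw.scal_pos _).ne' (hfi.scal_pos _).ne',
      Real.log_mul (hfw.scal_pos _).ne' (hfi.scal_pos _).ne', List.length_cons]
    have h10 : C * ε ^ α / (1 - D.σ ^ α) * (1 - (D.σ ^ α) ^ (w.length + 1)) =
        C * ε ^ α / (1 - D.σ ^ α) * (1 - (D.σ ^ α) ^ w.length) +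
          C * ε ^ α * (D.σ ^ α) ^ w.length := by
      have : 1 - D.σ ^ α ≠ 0 := by linarith
      field_simp
      ring
    rw [h10]
    calc _ = |(Real.log (scal d (wordMap D.f w) (D.f i x)) -
          Real.log (scal d (wordMap D.f w) (D.f i z))) +
          (Real.log (scal d (D.f i) x) - Real.log (scal d (D.f i) z))| := by
          congr 1
          ring
      _ ≤ _ := (abs_add_le _ _).trans (add_le_add h6 (h7.trans h8))

end

end ExpandingCover

end Words

/-! ### Small return branches -/

section Branches

variable {d : ℕ} [NeZero d] {M : Type*} [MetricSpace M] [CompactSpace M] [Nonempty M]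
  [ChartedSpace (EuclideanSpace ℝ (Fin d)) M]
  [IsManifold (𝓡 d) ∞ M] [RiemannianBundle (fun x : M => TangentSpace (𝓡 d) x)]
  [IsRiemannianManifold (𝓡 d) M] {N : ℕ} {g : Fin N → M → M} {D : ExpandingCover d g}

namespace ExpandingCover

/-- The ball supplied by mixing contains `V`, and its cylinder is mapped bijectively onto it; `S` is
the part of the cylinder lying over `V`. -/
theorem exists_mixing_branch (hg : ∀ i, IsConformalLocalDiffeo d (g i)) (hmix : D.IsMixing)
    {U : Set M} (hU : IsOpen U) (hU' : U.Nonempty) (hUd : diam U < D.η / 2)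
    {V : Set M} (hV : IsOpen V) (hV' : V.Nonempty) (hVd : diam V < D.η / 2) :
    ∃ h ∈ generatedSemigroup g, ∃ S : Set M, IsOpen S ∧ InjOn h S ∧ h '' S = V ∧ S ⊆ U ∧
      ∀ z ∈ S, D.σ⁻¹ ≤ scal d h z := by
  have hσ := D.σ_pos
  obtain ⟨x, w, ε, hε, hεη, hw, hVB, hcyl⟩ := hmix U V hU hU' hUd hV hV' hVd
  have hεr : ε < D.r := by linarith [D.η_lt, D.r_pos]
  obtain ⟨h1, h2, h3, h4, h5⟩ := cylinder_ball hg hε hεr (w := w) (x := x) hw.2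
  have hfw := isConformalLocalDiffeo_wordMap (D := D) hg w
  refine ⟨wordMap D.f w, wordMap_mem_generatedSemigroup D.f_mem w,
    D.cylinder w (ball (wordMap D.f w x) ε) ∩ wordMap D.f w ⁻¹' V,
    h1.inter (hV.preimage hfw.continuous), h3.mono inter_subset_left, ?_,
    inter_subset_left.trans hcyl, ?_⟩
  · rw [image_inter_preimage, h4]
    exact inter_eq_right.2 hVB
  · rintro z ⟨hz, -⟩
    refine le_trans ?_ (h5 z hz).2
    -- The word is nonempty, so at least one factor `σ⁻¹` of expansion is present.
    exact le_self_pow₀ ((one_le_inv₀ hσ).2 D.σ_lt_one.le)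
      (by simpa [List.length_eq_zero_iff] using hw.1)

/-- A long expanding word followed by a mixing branch. `K` bounds the distortion and `Q` the size of
the image of a ball of radius `R`; neither depends on `x` or `δ`, because only finitely many mixing
branches are used. -/
theorem exists_return_branches {α : ℝ≥0} (hα : 0 < α)
    (hg : ∀ i, IsConformalLocalDiffeo d (g i))
    (hlog : ∀ h ∈ generatedSemigroup g, ∀ x,
      LocHolderAt α (fun y => Real.log (scal d h y)) x)
    (hmix : D.IsMixing) {J : Type*} [Finite J] (V : J → Set M) (hV : ∀ c, IsOpen (V c))
    (hV' : ∀ c, (V c).Nonempty) (hVd : ∀ c, diam (V c) < D.η / 2) :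
    ∃ K Q : ℝ, 0 < K ∧ 0 < Q ∧ ∀ (c : J) (x : M) (δ : ℝ), 0 < δ →
      ∃ h ∈ generatedSemigroup g, ∃ (S : Set M) (R : ℝ), 0 < R ∧ R ≤ δ ∧ IsOpen S ∧
        InjOn h S ∧ h '' S = V c ∧ S ⊆ closedBall x R ∧ (∀ z ∈ S, D.σ⁻¹ < scal d h z) ∧
        (∀ y ∈ S, ∀ z ∈ S, scal d h y ≤ K * scal d h z) ∧ ∀ z ∈ S, R * scal d h z ≤ Q := by
  have hσ := D.σ_pos
  have hη := D.η_pos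
  have hηr := D.η_lt
  have hr := D.r_pos
  have hα' : (0 : ℝ) < α := hα
  -- a finite net
  obtain ⟨t, -, ht, htc⟩ := finite_cover_balls_of_compact (isCompact_univ (X := M))
    (e := D.η / 8) (by positivity)
  have hfin : Finite t := ht.to_subtype
  have hmixb : ∀ a : t × J, ∃ h ∈ generatedSemigroup g, ∃ S : Set M, IsOpen S ∧ InjOn h S ∧
      h '' S = V a.2 ∧ S ⊆ ball (a.1 : M) (D.η / 8) ∧ ∀ z ∈ S, D.σ⁻¹ ≤ scal d h z := fun a =>
    exists_mixing_branch hg hmix isOpen_ball ⟨_, mem_ball_self (by positivity)⟩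
      (lt_of_le_of_lt (diam_ball (by positivity)) (by linarith)) (hV _) (hV' _) (hVd _)
  choose h' hh' S' hS' hinj' himg' hsub' hexp' using hmixb
  have hΛ : ∃ Λ : ℝ, ∀ a x, |Real.log (scal d (h' a) x)| ≤ Λ := by
    choose A hA using fun a => exists_abs_log_scal_le hα (hlog (h' a) (hh' a))
    obtain ⟨Λ, hΛ⟩ := (Set.finite_range A).bddAbove
    exact ⟨Λ, fun a x => (hA a x).trans (hΛ ⟨a, rfl⟩)⟩
  obtain ⟨Λ, hΛ⟩ := hΛ
  have hC : ∃ C : ℝ, 0 ≤ C ∧ ∀ i x y,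
      |Real.log (scal d (D.f i) x) - Real.log (scal d (D.f i) y)| ≤ C * dist x y ^ (α : ℝ) := by
    choose A hA0 hA using fun i => LocHolderAt.exists_forall_dist_le hα (hlog (D.f i) (D.f_mem i))
    obtain ⟨C, hC⟩ := (Set.finite_range A).bddAbove
    refine ⟨max C 0, le_max_right _ _, fun i x y => (hA i x y).trans ?_⟩
    gcongr
    exact (hC ⟨i, rfl⟩).trans (le_max_left _ _)
  obtain ⟨C, hC0, hC⟩ := hC
  -- This ball around `f x` contains the net ball used later: radius `η / 8`, centre within `η / 8`
  -- of `f x`.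
  set ε := D.η / 2 with hε_def
  have hε : 0 < ε := by positivity
  have hεr : ε < D.r := by linarith
  set B := C * ε ^ (α : ℝ) / (1 - D.σ ^ (α : ℝ)) with hB_def
  have hq : D.σ ^ (α : ℝ) < 1 := Real.rpow_lt_one hσ.le D.σ_lt_one hα'
  have hq0 : 0 < D.σ ^ (α : ℝ) := Real.rpow_pos_of_pos hσ _
  have hB0 : 0 ≤ B := div_nonneg (by positivity) (by linarith)
  -- On the domain, the log factor of the long word is within `B` of its value at `x`, and that of
  -- the mixing branch is at most `Λ` in absolute value. Comparing two points doubles both.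
  refine ⟨Real.exp (2 * (Λ + B)), ε * Real.exp (Λ + 2 * B), by positivity, by positivity,
    fun c x δ hδ => ?_⟩
  -- Since the factor `a` at `x` is at least `σ⁻¹ ^ (n + 1)`, this choice makes the radius `exp B *
  -- ε / a` at most `δ`. The extra letter keeps the word nonempty, which makes the final expansion
  -- strict.
  obtain ⟨n, hn⟩ := exists_pow_lt_of_lt_one
    (show 0 < δ / (Real.exp B * ε) by positivity) D.σ_lt_one
  obtain ⟨w, hwl, hw⟩ := D.exists_admissibleFrom (n + 1) x
  obtain ⟨h1, h2, h3, h4, h5⟩ := cylinder_ball hg hε hεr hw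
  have h6 := abs_log_scal_wordMap_sub_le hg hα' hC0 hC hε hεr hw
  set f := wordMap D.f w with hf_def
  have hf : IsConformalLocalDiffeo d f := isConformalLocalDiffeo_wordMap hg w
  set T := D.cylinder w (ball (f x) ε) with hT
  set a := scal d f x with ha_def
  have ha : 0 < a := hf.scal_pos x
  have hdist : ∀ z ∈ T, |Real.log a - Real.log (scal d f z)| ≤ B := fun z hz =>
    (h6 z hz).trans (mul_le_of_le_one_right hB0 (sub_le_self _ (by positivity)))
  have haσ : D.σ⁻¹ ^ (n + 1) ≤ a := hwl ▸ (h5 x h2).2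
  -- the second part of the branch
  obtain ⟨q, hq', hfq⟩ : ∃ q ∈ t, dist (f x) q < D.η / 8 := by
    have := htc (mem_univ (f x))
    simpa using this
  set b : t × J := (⟨q, hq'⟩, c) with hb
  have hh := isConformalLocalDiffeo_of_mem hg (hh' b)
  have hS'T : S' b ⊆ f '' T := by
    rw [h4]
    refine (hsub' b).trans (ball_subset_ball' ?_)
    rw [dist_comm]
    linarith
  refine ⟨h' b ∘ f, comp_mem_generatedSemigroup (hh' b)
    (wordMap_mem_generatedSemigroup D.f_mem w), T ∩ f ⁻¹' S' b, Real.exp B * ε / a,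
    by positivity, ?_, h1.inter ((hS' b).preimage hf.continuous), ?_, ?_, ?_, ?_, ?_, ?_⟩
  · rw [div_le_iff₀ ha]
    rw [lt_div_iff₀ (by positivity)] at hn
    have h7 : 1 ≤ D.σ ^ n * a := by
      calc (1 : ℝ) = D.σ ^ n * D.σ⁻¹ ^ n := by rw [← mul_pow, mul_inv_cancel₀ hσ.ne', one_pow]
        _ ≤ D.σ ^ n * a := by
          gcongr
          exact (pow_le_pow_right₀ ((one_le_inv₀ hσ).2 D.σ_lt_one.le) (Nat.le_succ n)).trans haσ
    calc Real.exp B * ε ≤ Real.exp B * ε * (D.σ ^ n * a) :=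
          le_mul_of_one_le_right (by positivity) h7
      _ = D.σ ^ n * (Real.exp B * ε) * a := by ring
      _ ≤ δ * a := by gcongr
  · rintro y ⟨hy, hy'⟩ z ⟨hz, hz'⟩ hyz
    exact h3 hy hz (hinj' b hy' hz' hyz)
  · rw [image_comp, image_inter_preimage, inter_eq_right.2 hS'T, himg' b]
  · rintro z ⟨hz, -⟩
    -- On `T` the factor of `f` is at least `a * exp (-B)`, and `f` maps `T` onto a ball of radius
    -- `ε`, so `T` lies within `exp B * ε / a` of `x`.
    have h7 := hf.mul_dist_le h1 h3 (c := a * Real.exp (-B)) (by positivity) (fun y hy => by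
      have h8 := (abs_le.1 (hdist y hy)).2
      rw [← Real.exp_log ha, ← Real.exp_log (hf.scal_pos y), ← Real.exp_add]
      apply Real.exp_le_exp.2
      linarith) h2 hz (R := ε) h4.ge (by
        rw [← mem_ball', ← h4]
        exact mem_image_of_mem _ hz)
    have h8 : dist (f x) (f z) < ε := by
      rw [← mem_ball', ← h4]
      exact mem_image_of_mem _ hz
    rw [mem_closedBall', le_div_iff₀ ha]
    have h9 : dist x z * a = Real.exp B * (a * Real.exp (-B) * dist x z) := by
      rw [Real.exp_neg]
      field_simp
    rw [h9]
    gcongr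
    linarith
  · rintro z ⟨hz, hz'⟩
    rw [hh.scal_comp hf]
    have h7 := hexp' b (f z) hz'
    have h8 := (h5 z hz).2
    have h9 : 1 < D.σ⁻¹ := (one_lt_inv₀ hσ).2 D.σ_lt_one
    have h11 := (hh.scal_pos (f z)).le
    have h10 : 1 < D.σ⁻¹ ^ w.length := one_lt_pow₀ h9 (by omega)
    calc D.σ⁻¹ < D.σ⁻¹ * D.σ⁻¹ ^ w.length := lt_mul_of_one_lt_right (by positivity) h10
      _ ≤ _ := by gcongr
  · rintro y ⟨hy, hy'⟩ z ⟨hz, hz'⟩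
    rw [hh.scal_comp hf, hh.scal_comp hf, ← Real.exp_log (hf.scal_pos y),
      ← Real.exp_log (hf.scal_pos z), ← Real.exp_log (hh.scal_pos (f y)),
      ← Real.exp_log (hh.scal_pos (f z)), ← Real.exp_add, ← Real.exp_add, ← Real.exp_add]
    apply Real.exp_le_exp.2
    have e1 := abs_le.1 (hdist y hy)
    have e2 := abs_le.1 (hdist z hz)
    have e3 := abs_le.1 (hΛ b (f y))
    have e4 := abs_le.1 (hΛ b (f z))
    linarith [e1.1, e1.2, e2.1, e2.2, e3.1, e3.2, e4.1, e4.2]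
  · rintro z ⟨hz, hz'⟩
    rw [hh.scal_comp hf]
    have e1 := abs_le.1 (hdist z hz)
    have e2 := abs_le.1 (hΛ b (f z))
    have h7 : scal d (h' b) (f z) * scal d f z ≤ Real.exp (Λ + B) * a := by
      rw [← Real.exp_log (hf.scal_pos z), ← Real.exp_log (hh.scal_pos (f z)), ← Real.exp_log ha,
        ← Real.exp_add, ← Real.exp_add]
      apply Real.exp_le_exp.2
      linarith [e1.1, e2.2]
    calc Real.exp B * ε / a * (scal d (h' b) (f z) * scal d f z)
        ≤ Real.exp B * ε / a * (Real.exp (Λ + B) * a) := by gcongr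
      _ = ε * (Real.exp B * Real.exp (Λ + B)) := by field_simp
      _ = ε * Real.exp (Λ + 2 * B) := by
        rw [← Real.exp_add]
        congr 2
        ring

end ExpandingCover

end Branches

/-! ### Partitions into regular open sets and cells -/

section Partition

/-- A compact metric space with a finite measure is covered, up to a null set, by finitely many
disjoint small regular open sets. -/
theorem exists_regular_open_partition {X : Type*} [MetricSpace X] [CompactSpace X]
    [MeasurableSpace X] [OpensMeasurableSpace X] (μ : Measure X) [IsFiniteMeasure μ] {ρ : ℝ}
    (hρ : 0 < ρ) :
    ∃ (n : ℕ) (B : Fin n → Set X) (p : Fin n → X), (∀ c, IsOpen (B c)) ∧ (∀ c, (B c).Nonempty) ∧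
      (∀ c, interior (closure (B c)) = B c) ∧ Pairwise (fun c c' => Disjoint (B c) (B c')) ∧
      (∀ c, B c ⊆ closedBall (p c) ρ) ∧ μ (⋃ c, B c)ᶜ = 0 := by
  classical
  have hrad : ∀ x : X, ∃ s ∈ Ioo (ρ / 2) ρ, μ (frontier (ball x s)) = 0 := by
    intro x
    obtain ⟨s, hs, h⟩ := exists_null_frontier_thickening μ {x} (half_lt_self hρ)
    exact ⟨s, hs, by rwa [thickening_singleton] at h⟩
  choose s hs hfr using hrad
  obtain ⟨t, ht⟩ := isCompact_univ.elim_finite_subcover (fun x => ball x (s x))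
    (fun x => isOpen_ball) (fun x _ => mem_iUnion.2 ⟨x, mem_ball_self (by
      have := (hs x).1; linarith)⟩)
  set e := t.equivFin with he
  set q : Fin t.card → X := fun i => e.symm i with hq
  have hcov : ∀ x, ∃ i, x ∈ ball (q i) (s (q i)) := by
    intro x
    obtain ⟨y, hy, hxy⟩ := mem_iUnion₂.1 (ht (mem_univ x))
    exact ⟨e ⟨y, hy⟩, by simpa [hq] using hxy⟩
  -- Each ball is stripped of the closures of the earlier ones, so that the pieces are open and
  -- disjoint.
  set O : Fin t.card → Set X := fun i =>
    ball (q i) (s (q i)) \ ⋃ j ∈ {j | j < i}, closure (ball (q j) (s (q j))) with hO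
  have hOopen : ∀ i, IsOpen (O i) := fun i =>
    isOpen_ball.sdiff ((Set.toFinite _).isClosed_biUnion fun _ _ => isClosed_closure)
  have hOdisj : ∀ i j, i < j → Disjoint (O i) (O j) := by
    intro i j hij
    rw [Set.disjoint_left]
    intro x hx hx'
    exact hx'.2 (mem_biUnion (show i ∈ {k | k < j} from hij) (subset_closure hx.1))
  have hOdisj' : ∀ i j, i ≠ j → Disjoint (O i) (O j) := by
    intro i j hij
    rcases lt_or_gt_of_ne hij with h | h
    · exact hOdisj i j h
    · exact (hOdisj j i h).symm
  -- Empty pieces are discarded. Replacing the others by the interiors of their closures makes them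
  -- regular without losing disjointness.
  set e' := Fintype.equivFin {i // (O i).Nonempty} with he'
  have hsub : ∀ i, O i ⊆ interior (closure (O i)) := fun i =>
    interior_maximal subset_closure (hOopen i)
  refine ⟨_, fun c => interior (closure (O (e'.symm c))), fun c => q (e'.symm c),
    fun c => isOpen_interior, fun c => (e'.symm c).2.mono (hsub _), fun c => interior_closure_idem,
    ?_, ?_, ?_⟩
  · intro c c' hcc
    have h1 : Disjoint (O (e'.symm c)) (O (e'.symm c')) :=
      hOdisj' _ _ fun h => hcc (e'.symm.injective (Subtype.ext h))
    have h2 : Disjoint (closure (O (e'.symm c))) (O (e'.symm c')) := h1.closure_left (hOopen _)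
    exact ((h2.mono_left interior_subset).closure_right isOpen_interior).mono_right
      interior_subset
  · intro c
    refine interior_subset.trans (closure_minimal ?_ isClosed_closedBall)
    exact sdiff_subset.trans (ball_subset_closedBall.trans
      (closedBall_subset_closedBall (hs _).2.le))
  · refine measure_mono_null (t := ⋃ i, frontier (ball (q i) (s (q i)))) ?_
      (measure_iUnion_null fun i => hfr _)
    intro x hx
    by_contra hx'
    apply hx
    simp only [mem_iUnion, not_exists] at hx'
    -- Let `i` be the first index whose ball contains `x`. If `x` were in the closure of an earlier
    -- ball, it would be on its null frontier; otherwise `x` lies in `O i`.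
    have hne : (Finset.univ.filter fun i => x ∈ ball (q i) (s (q i))).Nonempty := by
      obtain ⟨i, hi⟩ := hcov x
      exact ⟨i, by simpa using hi⟩
    obtain ⟨i, hi, hmin⟩ := Finset.exists_minimal hne
    simp only [Finset.mem_filter, Finset.mem_univ, true_and] at hi hmin
    have hxO : x ∈ O i := by
      refine ⟨hi, ?_⟩
      simp only [mem_iUnion, not_exists]
      intro j hj hxj
      have hxj' : x ∉ ball (q j) (s (q j)) := fun h => absurd (hmin h (le_of_lt hj)) (not_le.2 hj)
      apply hx' j
      rw [isOpen_ball.frontier_eq]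
      exact ⟨hxj, hxj'⟩
    refine mem_iUnion.2 ⟨e' ⟨i, ⟨x, hxO⟩⟩, ?_⟩
    simpa using hsub i hxO

end Partition

/-! ### Cells of branches -/

section Cells

/-- The preimage in `S` of the closure of a regular open set `B` under a map which is open,
continuous and injective on `S`. -/
theorem cell_properties {X : Type*} [MetricSpace X] [CompactSpace X] {h : X → X}
    (hc : Continuous h) (ho : IsOpenMap h) {S B : Set X} (hS : IsOpen S) (hinj : InjOn h S)
    (hB : IsOpen B) (hBreg : interior (closure B) = B) (hBS : closure B ⊆ h '' S) :
    IsClosed (S ∩ h ⁻¹' closure B) ∧ h '' (S ∩ h ⁻¹' closure B) = closure B ∧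
      interior (S ∩ h ⁻¹' closure B) = S ∩ h ⁻¹' B ∧
      closure (S ∩ h ⁻¹' B) = S ∩ h ⁻¹' closure B ∧ h '' (S ∩ h ⁻¹' B) = B := by
  have himg : h '' (S ∩ h ⁻¹' closure B) = closure B := by
    rw [image_inter_preimage]
    exact inter_eq_right.2 hBS
  have himg' : h '' (S ∩ h ⁻¹' B) = B := by
    rw [image_inter_preimage]
    exact inter_eq_right.2 (subset_closure.trans hBS)
  have hint : interior (S ∩ h ⁻¹' closure B) = S ∩ h ⁻¹' B := by
    apply Subset.antisymm
    · intro x hx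
      refine ⟨(interior_subset hx).1, ?_⟩
      -- Openness of `h` and regularity of `B` exclude interior points lying over the boundary of
      -- `B`.
      have h1 : h '' interior (S ∩ h ⁻¹' closure B) ⊆ interior (closure B) := by
        refine interior_maximal ?_ (ho _ isOpen_interior)
        exact (image_mono interior_subset).trans himg.subset
      rw [hBreg] at h1
      exact h1 (mem_image_of_mem h hx)
    · exact interior_maximal (inter_subset_inter_right _ (preimage_mono subset_closure))
        (hS.inter (hB.preimage hc))
  -- `S` is only open; the cell is closed as the image of the compact set `closure B` under the
  -- continuous inverse branch.
  have hclosed : IsClosed (S ∩ h ⁻¹' closure B) := by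
    rcases S.eq_empty_or_nonempty with rfl | ⟨z, hz⟩
    · simp
    have : Nonempty X := ⟨z⟩
    have hcont : ContinuousOn (Function.invFunOn h S) (closure B) := by
      intro y hy
      obtain ⟨x, hx, rfl⟩ := hBS hy
      have hinv : ∀ y ∈ S, Function.invFunOn h S (h y) = y := fun y hy =>
        hinj.leftInvOn_invFunOn hy
      refine ContinuousAt.continuousWithinAt ?_
      rw [ContinuousAt, hinv x hx]
      intro U hU
      have h1 : h '' (S ∩ U) ∈ 𝓝 (h x) := ho.image_mem_nhds (Filter.inter_mem (hS.mem_nhds hx) hU)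
      rw [Filter.mem_map]
      filter_upwards [h1]
      rintro _ ⟨y, ⟨hy, hyU⟩, rfl⟩
      rw [mem_preimage, hinv y hy]
      exact hyU
    have heq : S ∩ h ⁻¹' closure B = Function.invFunOn h S '' closure B := by
      conv_rhs => rw [← himg, image_image]
      exact ((image_congr fun y hy => hinj.leftInvOn_invFunOn hy.1).trans (image_id' _)).symm
    rw [heq]
    exact (isClosed_closure.isCompact.image_of_continuousOn hcont).isClosed
  refine ⟨hclosed, himg, hint, ?_, himg'⟩
  apply Subset.antisymm
  · exact closure_minimal (inter_subset_inter_right _ (preimage_mono subset_closure)) hclosed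
  · rintro x ⟨hx, hxB⟩
    rw [_root_.mem_closure_iff]
    intro U hU hxU
    obtain ⟨y, ⟨z, ⟨hzS, hzU⟩, rfl⟩, hzB⟩ :=
      _root_.mem_closure_iff.1 hxB (h '' (S ∩ U)) (ho _ (hS.inter hU)) ⟨x, ⟨hx, hxU⟩, rfl⟩
    exact ⟨z, hzU, hzS, hzB⟩

/-- A branch onto a set `B` containing a ball contains itself a ball of comparable size. -/
theorem IsConformalLocalDiffeo.ball_subset_preimage {d : ℕ} [NeZero d] {M : Type*} [MetricSpace M]
    [ProperSpace M] [ChartedSpace (EuclideanSpace ℝ (Fin d)) M] [IsManifold (𝓡 d) ∞ M]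
    [RiemannianBundle (fun x : M => TangentSpace (𝓡 d) x)] [IsRiemannianManifold (𝓡 d) M]
    {h : M → M} (hh : IsConformalLocalDiffeo d h) {S B : Set M} (hS : IsOpen S)
    (hinj : InjOn h S) (hBS : B ⊆ h '' S) {b : M} {s : ℝ} (hs : 0 < s) (hb : ball b s ⊆ B)
    {R Q : ℝ} (hR : 0 < R) (hQ : 0 < Q) (hRQ : ∀ z ∈ S, R * scal d h z ≤ Q) :
    ∃ u ∈ S, h u = b ∧ ball u (s / (2 * Q) * R) ⊆ S ∩ h ⁻¹' B := by
  obtain ⟨u, hu, rfl⟩ := hBS (hb (mem_ball_self hs))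
  refine ⟨u, hu, rfl, fun v hv => ?_⟩
  -- The factor is at most `Q / R` on `S`, so points within `s / (2 * Q) * R` of `u` have images
  -- within `s / 2` of `h u`.
  have key := hh.mem_of_dist_lt (S := S ∩ h ⁻¹' ball (h u) s)
    (hS.inter (isOpen_ball.preimage hh.continuous)) (hinj.mono inter_subset_left)
    (L := Q / R) (by positivity) (fun x hx => by
      rw [le_div_iff₀ hR, mul_comm]
      exact hRQ x hx.1) (u := u) (v := v) ⟨hu, mem_ball_self hs⟩ (ρ := s / 2) (by
      rw [image_inter_preimage, inter_eq_right.2 (hb.trans hBS)]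
      exact closedBall_subset_ball (half_lt_self hs)) (by
      rw [mem_ball'] at hv
      calc Q / R * dist u v < Q / R * (s / (2 * Q) * R) := by gcongr
        _ = s / 2 := by field_simp)
  exact ⟨key.1, hb key.2⟩

end Cells

/-! ### Systems of return branches -/

section ReturnSystem

theorem isFiniteMeasure_euclideanHausdorffMeasure (d : ℕ) (M : Type*) [MetricSpace M]
    [CompactSpace M] [MeasurableSpace M]
    [BorelSpace M] [ChartedSpace (EuclideanSpace ℝ (Fin d)) M]
    [IsManifold (𝓡 d) ∞ M] [RiemannianBundle (fun x : M => TangentSpace (𝓡 d) x)]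
    [IsContMDiffRiemannianBundle (𝓡 d) ∞ (EuclideanSpace ℝ (Fin d))
      (fun x : M => TangentSpace (𝓡 d) x)]
    [IsRiemannianManifold (𝓡 d) M] :
    IsFiniteMeasure (Measure.euclideanHausdorffMeasure d : Measure M) := by
  obtain ⟨ρ, hρ, c, hc, C, hC, h⟩ := exists_ahlfors d M
  refine ⟨isCompact_univ.measure_lt_top_of_nhdsWithin fun x _ => ?_⟩
  exact ⟨closedBall x ρ, mem_nhdsWithin_of_mem_nhds (closedBall_mem_nhds x hρ),
    (h x ρ hρ le_rfl).2.trans_lt ENNReal.ofReal_lt_top⟩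

theorem isOpenPosMeasure_euclideanHausdorffMeasure (d : ℕ) (M : Type*) [MetricSpace M]
    [CompactSpace M] [MeasurableSpace M]
    [BorelSpace M] [ChartedSpace (EuclideanSpace ℝ (Fin d)) M]
    [IsManifold (𝓡 d) ∞ M] [RiemannianBundle (fun x : M => TangentSpace (𝓡 d) x)]
    [IsContMDiffRiemannianBundle (𝓡 d) ∞ (EuclideanSpace ℝ (Fin d))
      (fun x : M => TangentSpace (𝓡 d) x)]
    [IsRiemannianManifold (𝓡 d) M] :
    (Measure.euclideanHausdorffMeasure d : Measure M).IsOpenPosMeasure := by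
  obtain ⟨ρ, hρ, c, hc, C, hC, h⟩ := exists_ahlfors d M
  refine ⟨fun U hU ⟨x, hx⟩ h0 => ?_⟩
  obtain ⟨s, hs, hsU⟩ := Metric.isOpen_iff.1 hU x hx
  have h1 := (h x (min s ρ) (lt_min hs hρ) (min_le_right _ _)).1
  have h2 : Measure.euclideanHausdorffMeasure d (ball x (min s ρ)) = 0 :=
    measure_mono_null ((ball_subset_ball (min_le_left _ _)).trans hsU) h0
  rw [h2, nonpos_iff_eq_zero, ENNReal.ofReal_eq_zero] at h1
  have : 0 < min s ρ := lt_min hs hρ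
  exact absurd h1 (not_le.2 (by positivity))

/-- Finitely many disjoint regular open sets `B c`, each contained in a small ball, and countably
many uniformly expanding branches with bounded distortion, each mapping a subset of some `B c`
onto a ball containing the closure of the same `B c`; the preimages of the sets `closure (B c)` are
disjoint and cover `M` up to a null set. -/
structure ReturnSystem (d : ℕ) {M : Type*} [MetricSpace M] [MeasurableSpace M] [BorelSpace M]
    [ChartedSpace (EuclideanSpace ℝ (Fin d)) M]
    [IsManifold (𝓡 d) ∞ M] [RiemannianBundle (fun x : M => TangentSpace (𝓡 d) x)]
    {N : ℕ} (g : Fin N → M → M) (ι : Type) where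
  n : ℕ
  B : Fin n → Set M
  center : Fin n → M
  ρ : ℝ
  σ : ℝ
  K : ℝ
  cls : ι → Fin n
  map : ι → M → M
  dom : ι → Set M
  ρ_pos : 0 < ρ
  σ_pos : 0 < σ
  σ_lt_one : σ < 1
  K_pos : 0 < K
  isOpen_B : ∀ c, IsOpen (B c)
  nonempty_B : ∀ c, (B c).Nonempty
  regular_B : ∀ c, interior (closure (B c)) = B c
  disjoint_B : Pairwise fun c c' => Disjoint (B c) (B c')
  B_subset : ∀ c, B c ⊆ closedBall (center c) ρ
  map_mem : ∀ i, map i ∈ generatedSemigroup g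
  conformal : ∀ i, IsConformalLocalDiffeo d (map i)
  isOpen_dom : ∀ i, IsOpen (dom i)
  injOn : ∀ i, InjOn (map i) (dom i)
  image_dom : ∀ i, map i '' dom i = ball (center (cls i)) (4 * ρ)
  dom_subset : ∀ i, dom i ⊆ B (cls i)
  expanding : ∀ i, ∀ z ∈ dom i, σ⁻¹ < scal d (map i) z
  distortion : ∀ i, ∀ y ∈ dom i, ∀ z ∈ dom i, scal d (map i) y ≤ K * scal d (map i) z
  disjoint_cell : Pairwise fun i j =>
    Disjoint (dom i ∩ map i ⁻¹' closure (B (cls i))) (dom j ∩ map j ⁻¹' closure (B (cls j)))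
  full : (Measure.euclideanHausdorffMeasure d : Measure M)
    (⋃ i, dom i ∩ map i ⁻¹' closure (B (cls i)))ᶜ = 0

/-- Cells of return branches at all points and scales form a Vitali family in the union of the `B
c`; a disjoint subfamily covering almost everything is the desired system. -/
theorem ExpandingCover.exists_returnSystem {d : ℕ} [NeZero d] {M : Type*} [MetricSpace M]
    [CompactSpace M] [Nonempty M] [MeasurableSpace M] [BorelSpace M]
    [ChartedSpace (EuclideanSpace ℝ (Fin d)) M]
    [IsManifold (𝓡 d) ∞ M] [RiemannianBundle (fun x : M => TangentSpace (𝓡 d) x)]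
    [IsContMDiffRiemannianBundle (𝓡 d) ∞ (EuclideanSpace ℝ (Fin d))
      (fun x : M => TangentSpace (𝓡 d) x)]
    [IsRiemannianManifold (𝓡 d) M] {N : ℕ} {g : Fin N → M → M} {D : ExpandingCover d g}
    {α : ℝ≥0} (hα : 0 < α) (hg : ∀ i, IsConformalLocalDiffeo d (g i))
    (hlog : ∀ h ∈ generatedSemigroup g, ∀ x,
      LocHolderAt α (fun y => Real.log (scal d h y)) x)
    (hmix : D.IsMixing) : ∃ (ι : Type) (_ : Countable ι), Nonempty (ReturnSystem d g ι) := by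
  have hη := D.η_pos
  -- The targets have radius `4ρ`, hence diameter at most `8ρ = 2η / 5 < η / 2`, as mixing requires.
  set ρ : ℝ := D.η / 20 with hρdef
  have hρ : 0 < ρ := by positivity
  set μ : Measure M := Measure.euclideanHausdorffMeasure d with hμ
  have : IsFiniteMeasure μ := isFiniteMeasure_euclideanHausdorffMeasure d M
  obtain ⟨n, B, p, hBo, hBne, hBreg, hBdisj, hBsub, hBfull⟩ := exists_regular_open_partition μ hρ
  obtain ⟨K, Q, hK, hQ, hbr⟩ := exists_return_branches hα hg hlog hmix
    (fun c => ball (p c) (4 * ρ)) (fun c => isOpen_ball)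
    (fun c => ⟨p c, mem_ball_self (by positivity)⟩)
    (fun c => (diam_ball (by positivity)).trans_lt (by rw [hρdef]; linarith))
  have hBcl : ∀ c, closure (B c) ⊆ ball (p c) (4 * ρ) := fun c =>
    (closure_minimal (hBsub c) isClosed_closedBall).trans (closedBall_subset_ball (by linarith))
  obtain ⟨s, hs, b, hb⟩ : ∃ s > 0, ∃ b : Fin n → M, ∀ c, ball (b c) s ⊆ B c := by
    choose b hb using hBne
    have h1 : ∀ c, ∃ s > 0, ball (b c) s ⊆ B c := fun c => Metric.isOpen_iff.1 (hBo c) _ (hb c)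
    choose s hs hsB using h1
    have h2 : ∀ᶠ t in 𝓝[>] (0 : ℝ), ∀ c, t < s c :=
      Filter.eventually_all.2 fun c => mem_nhdsWithin_of_mem_nhds (Iio_mem_nhds (hs c))
    obtain ⟨t, ht, ht0⟩ := (h2.and self_mem_nhdsWithin).exists
    exact ⟨t, ht0, b, fun c => (ball_subset_ball (ht c).le).trans (hsB c)⟩
  obtain ⟨ρA, hρA, c₁, hc₁, C₁, hC₁, hA⟩ := exists_ahlfors d M
  -- An index consists of a class, a point of `B c` and a scale `k`. The radius is taken small
  -- enough to tend to zero with `k`, to keep the domain inside `B c`, and to use Ahlfors regularity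
  -- at radius `3R`.
  have hbr' : ∀ a : (Σ c : Fin n, B c × ℕ), ∃ h ∈ generatedSemigroup g, ∃ (S : Set M) (R : ℝ),
      0 < R ∧ R ≤ 1 / (a.2.2 + 1) ∧ 3 * R ≤ ρA ∧ IsOpen S ∧ InjOn h S ∧
      h '' S = ball (p a.1) (4 * ρ) ∧ S ⊆ closedBall a.2.1 R ∧ S ⊆ B a.1 ∧
      (∀ z ∈ S, D.σ⁻¹ < scal d h z) ∧
      (∀ y ∈ S, ∀ z ∈ S, scal d h y ≤ K * scal d h z) ∧ ∀ z ∈ S, R * scal d h z ≤ Q := by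
    rintro ⟨c, ⟨x, hx⟩, k⟩
    obtain ⟨r, hr, hrB⟩ := Metric.nhds_basis_closedBall.mem_iff.1 ((hBo c).mem_nhds hx)
    have hδ : 0 < min (1 / ((k : ℝ) + 1)) (min r (ρA / 3)) := by positivity
    obtain ⟨h, hh, S, R, hR, hRδ, h1, h2, h3, h4, h5⟩ := hbr c x _ hδ
    refine ⟨h, hh, S, R, hR, hRδ.trans (min_le_left _ _), ?_, h1, h2, h3, h4, ?_, h5⟩
    · have := hRδ.trans ((min_le_right _ _).trans (min_le_right _ _))
      linarith
    · exact (h4.trans (closedBall_subset_closedBall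
        (hRδ.trans ((min_le_right _ _).trans (min_le_left _ _))))).trans hrB
  choose h hΓ S R hR hRk hRA hSo hinj himg hSR hSB hexp hdist hRQ using hbr'
  have hhc : ∀ a, IsConformalLocalDiffeo d (h a) := fun a =>
    isConformalLocalDiffeo_of_mem hg (hΓ a)
  have hcell := fun a : (Σ c : Fin n, B c × ℕ) =>
    cell_properties (hhc a).continuous (hhc a).isOpenMap (hSo a) (hinj a) (hBo a.1) (hBreg a.1)
      (by rw [himg a]; exact hBcl a.1)
  set κ : ℝ := min 1 (s / (2 * Q)) with hκdef
  have hκ : 0 < κ := lt_min one_pos (by positivity)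
  -- The Vitali constant compares the upper volume bound at radius `3R` with the lower bound at
  -- radius `κR`, the size of a ball inside the cell.
  obtain ⟨u, -, huc, hud, hu0⟩ := Vitali.exists_disjoint_covering_ae μ (⋃ c, B c) Set.univ
    (Real.toNNReal (C₁ * 3 ^ d / (c₁ * κ ^ d))) R (fun a : (Σ c : Fin n, B c × ℕ) => (a.2.1 : M))
    (fun a => S a ∩ h a ⁻¹' closure (B a.1))
    (fun a _ => inter_subset_left.trans (hSR a))
    (by
      intro a _
      obtain ⟨v, hv, -, hvB⟩ := (hhc a).ball_subset_preimage (hSo a) (hinj a)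
        ((hcell a).2.2.2.2 ▸ image_mono inter_subset_left) hs (hb a.1) (hR a) hQ (hRQ a)
      have h1 : ENNReal.ofReal (c₁ * (κ * R a) ^ d) ≤ μ (S a ∩ h a ⁻¹' closure (B a.1)) := by
        refine (hA v (κ * R a) (mul_pos hκ (hR a)) ?_).1.trans (measure_mono ?_)
        · calc κ * R a ≤ 1 * R a := by
                gcongr
                · exact (hR a).le
                · exact min_le_left _ _
            _ ≤ ρA := by linarith [hRA a, hR a]
        · refine (ball_subset_ball ?_).trans (hvB.trans
            (inter_subset_inter_right _ (preimage_mono subset_closure)))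
          gcongr
          · exact (hR a).le
          · exact min_le_right _ _
      calc μ (closedBall (a.2.1 : M) (3 * R a))
          ≤ ENNReal.ofReal (C₁ * (3 * R a) ^ d) :=
            (hA _ _ (mul_pos three_pos (hR a)) (hRA a)).2
        _ = ENNReal.ofReal (C₁ * 3 ^ d / (c₁ * κ ^ d)) *
            ENNReal.ofReal (c₁ * (κ * R a) ^ d) := by
            rw [← ENNReal.ofReal_mul (by positivity)]
            congr 1
            rw [mul_pow, mul_pow]
            field_simp
        _ ≤ _ := by
            gcongr
            exact le_rfl)
    (by
      intro a _
      rw [(hcell a).2.2.1]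
      exact Nonempty.of_image (f := h a) (by rw [(hcell a).2.2.2.2]; exact hBne a.1))
    (fun a _ => (hcell a).1)
    (by
      intro x hx ε hε
      obtain ⟨c, hc⟩ := mem_iUnion.1 hx
      obtain ⟨k, hk⟩ := exists_nat_one_div_lt hε
      exact ⟨⟨c, ⟨x, hc⟩, k⟩, mem_univ _, (hRk ⟨c, ⟨x, hc⟩, k⟩).trans hk.le, rfl⟩)
  have : Countable u := huc.to_subtype
  -- The selected family is indexed by points of `M`, in whose universe it lives; countability
  -- allows reindexing by natural numbers, in `Type`.
  obtain ⟨f, hf⟩ := exists_injective_nat u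
  set e := Equiv.ofInjective f hf with he
  refine ⟨range f, inferInstance, ⟨{
    n := n, B := B, center := p, ρ := ρ, σ := D.σ, K := K
    cls := fun i => (e.symm i).1.1
    map := fun i => h (e.symm i).1
    dom := fun i => S (e.symm i).1
    ρ_pos := hρ, σ_pos := D.σ_pos, σ_lt_one := D.σ_lt_one, K_pos := hK
    isOpen_B := hBo, nonempty_B := hBne, regular_B := hBreg, disjoint_B := hBdisj
    B_subset := hBsub
    map_mem := fun i => hΓ _
    conformal := fun i => hhc _
    isOpen_dom := fun i => hSo _
    injOn := fun i => hinj _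
    image_dom := fun i => himg _
    dom_subset := fun i => hSB _
    expanding := fun i => hexp _
    distortion := fun i => hdist _
    disjoint_cell := ?_
    full := ?_ }⟩⟩
  · intro i j hij
    exact hud (e.symm i).2 (e.symm j).2 fun hij' => hij (e.symm.injective (Subtype.ext hij'))
  · refine measure_mono_null (t := (⋃ c, B c)ᶜ ∪ ((⋃ c, B c) \
      ⋃ a ∈ u, S a ∩ h a ⁻¹' closure (B a.1))) ?_ (measure_union_null hBfull hu0)
    intro x hx
    by_cases hxB : x ∈ ⋃ c, B c
    · refine Or.inr ⟨hxB, fun hxu => hx ?_⟩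
      obtain ⟨a, ha, hxa⟩ := mem_iUnion₂.1 hxu
      refine mem_iUnion.2 ⟨e ⟨a, ha⟩, ?_⟩
      simpa using hxa
    · exact Or.inl hxB

end ReturnSystem

/-! ### Inducing schemes from systems of return branches -/

section InducingScheme

namespace ReturnSystem

variable {d : ℕ} {M : Type*} [MetricSpace M]
  [MeasurableSpace M] [BorelSpace M] [ChartedSpace (EuclideanSpace ℝ (Fin d)) M]
  [IsManifold (𝓡 d) ∞ M] [RiemannianBundle (fun x : M => TangentSpace (𝓡 d) x)]
  {N : ℕ} {g : Fin N → M → M} {ι : Type} (Y : ReturnSystem d g ι)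

/-- The preimage of `closure (B c)` under a branch. -/
def cell (i : ι) : Set M := Y.dom i ∩ Y.map i ⁻¹' closure (Y.B (Y.cls i))

theorem closure_B_subset (c : Fin Y.n) : closure (Y.B c) ⊆ closedBall (Y.center c) Y.ρ :=
  closure_minimal (Y.B_subset c) isClosed_closedBall

theorem closure_B_subset_image (i : ι) : closure (Y.B (Y.cls i)) ⊆ Y.map i '' Y.dom i := by
  rw [Y.image_dom]
  exact (Y.closure_B_subset _).trans (closedBall_subset_ball (by linarith [Y.ρ_pos]))

theorem cell_subset_dom (i : ι) : Y.cell i ⊆ Y.dom i := inter_subset_left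

theorem cell_subset_B (i : ι) : Y.cell i ⊆ Y.B (Y.cls i) := inter_subset_left.trans (Y.dom_subset i)

theorem cls_eq_of_mem {c c' : Fin Y.n} {x : M} (h : x ∈ Y.B c) (h' : x ∈ Y.B c') : c = c' := by
  by_contra hne
  exact Set.disjoint_left.1 (Y.disjoint_B hne) h h'

theorem cls_eq_of_cell_subset {c : Fin Y.n} {x : M} {i : ι} (h : x ∈ Y.cell i) (h' : x ∈ Y.B c) :
    Y.cls i = c :=
  Y.cls_eq_of_mem (Y.cell_subset_B i h) h'

open Classical in
/-- The induced map of a system of return branches; it is the identity outside of the inducing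
domain. -/
noncomputable def inducedMap (x : M) : M :=
  if h : ∃ i, x ∈ interior (Y.cell i) then Y.map h.choose x else x

theorem inducedMap_eq {i : ι} {x : M} (hx : x ∈ interior (Y.cell i)) :
    Y.inducedMap x = Y.map i x := by
  have h : ∃ i, x ∈ interior (Y.cell i) := ⟨i, hx⟩
  rw [inducedMap, dif_pos h]
  congr 2
  by_contra hne
  exact Set.disjoint_left.1 (Y.disjoint_cell hne) (interior_subset h.choose_spec)
    (interior_subset hx)

section Properties

variable [NeZero d] [CompactSpace M] (i : ι)

theorem cell_props : IsClosed (Y.cell i) ∧ Y.map i '' Y.cell i = closure (Y.B (Y.cls i)) ∧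
    interior (Y.cell i) = Y.dom i ∩ Y.map i ⁻¹' Y.B (Y.cls i) ∧
    closure (Y.dom i ∩ Y.map i ⁻¹' Y.B (Y.cls i)) = Y.cell i ∧
    Y.map i '' (Y.dom i ∩ Y.map i ⁻¹' Y.B (Y.cls i)) = Y.B (Y.cls i) :=
  cell_properties (Y.conformal i).continuous
    (Y.conformal i).isOpenMap (Y.isOpen_dom i) (Y.injOn i) (Y.isOpen_B _)
    (Y.regular_B _) (Y.closure_B_subset_image i)

theorem isClosed_cell : IsClosed (Y.cell i) := (Y.cell_props i).1

theorem image_cell : Y.map i '' Y.cell i = closure (Y.B (Y.cls i)) := (Y.cell_props i).2.1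

theorem closure_interior_cell : closure (interior (Y.cell i)) = Y.cell i := by
  rw [(Y.cell_props i).2.2.1, (Y.cell_props i).2.2.2.1]

theorem image_interior_cell : Y.map i '' interior (Y.cell i) = Y.B (Y.cls i) := by
  rw [(Y.cell_props i).2.2.1, (Y.cell_props i).2.2.2.2]

theorem nonempty_cell : (Y.cell i).Nonempty :=
  (Nonempty.of_image (f := Y.map i) (by
    rw [Y.image_interior_cell i]; exact Y.nonempty_B _)).mono interior_subset

theorem cell_subset_image {j : ι} (hij : Y.cls i = Y.cls j) : Y.cell j ⊆ Y.map i '' Y.cell i := by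
  rw [Y.image_cell, hij]
  exact (Y.cell_subset_B j).trans subset_closure

/-- The interior of cell `i` is mapped onto `B (cls i)` while cell `j` lies in `B (cls j)`; as the
sets `B c` are disjoint, meeting forces equal classes. -/
theorem cls_eq_of_nonempty {j : ι}
    (h : (interior (Y.cell i) ∩ Y.map i ⁻¹' interior (Y.cell j)).Nonempty) :
    Y.cls i = Y.cls j := by
  obtain ⟨x, hx, hxj⟩ := h
  refine (Y.cls_eq_of_cell_subset (interior_subset hxj) ?_).symm
  rw [← Y.image_interior_cell i]
  exact mem_image_of_mem _ hx

/-- The domain is the image of a ball under the continuous inverse branch, and Riemannian balls are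
connected. -/
theorem isConnected_dom [IsRiemannianManifold (𝓡 d) M] : IsConnected (Y.dom i) := by
  obtain ⟨k, hk, hkh, -⟩ :=
    (Y.conformal i).exists_inverse (Y.isOpen_dom i) (Y.injOn i)
  have h1 : Y.dom i = k '' (Y.map i '' Y.dom i) := by
    rw [image_image]
    exact ((image_congr hkh).trans (image_id' _)).symm
  rw [h1]
  refine IsConnected.image ?_ _ hk.continuousOn
  rw [Y.image_dom]
  exact isConnected_ball_of_riemannian (𝓡 d) _ (by linarith [Y.ρ_pos])

theorem dist_le_of_mem_cell [IsRiemannianManifold (𝓡 d) M] {x y : M} (hx : x ∈ Y.cell i)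
    (hy : y ∈ Y.cell i) : dist x y ≤ Y.σ * dist (Y.map i x) (Y.map i y) := by
  have hσ := Y.σ_pos
  have hρ := Y.ρ_pos
  have hx' := mem_closedBall.1 (Y.closure_B_subset _ hx.2)
  have hy' := mem_closedBall.1 (Y.closure_B_subset _ hy.2)
  -- Both images lie within `ρ` of the centre, hence at most `2ρ < 3ρ` apart, and a ball of radius
  -- `3ρ` around either fits in the image ball of radius `4ρ`.
  have := (Y.conformal i).mul_dist_le (Y.isOpen_dom i) (Y.injOn i)
    (inv_pos.2 hσ) (fun z hz => (Y.expanding i z hz).le) hx.1 hy.1 (R := 3 * Y.ρ) (by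
      rw [Y.image_dom]
      exact ball_subset_ball' (by linarith))
    (by linarith [dist_triangle_right (Y.map i x) (Y.map i y) (Y.center (Y.cls i))])
  rwa [inv_mul_le_iff₀ hσ] at this

end Properties

variable [NeZero d] [CompactSpace M]

/-- A nonempty open `B c` has positive volume, so the cells cannot all avoid it. -/
theorem exists_cls_eq [(Measure.euclideanHausdorffMeasure d : Measure M).IsOpenPosMeasure]
    (c : Fin Y.n) : ∃ i, Y.cls i = c := by
  by_contra! hne
  refine (Y.isOpen_B c).measure_ne_zero (Measure.euclideanHausdorffMeasure d : Measure M)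
    (Y.nonempty_B c) (measure_mono_null (t := (⋃ i, Y.cell i)ᶜ) (fun x hx hx' => ?_) Y.full)
  obtain ⟨i, hi⟩ := mem_iUnion.1 hx'
  exact hne i (Y.cls_eq_of_cell_subset hi hx)

/-- The Markov partition of a system of return branches. -/
def markovPartition : MarkovPartition d g ι where
  cell := Y.cell
  map := Y.map
  isClosed_cell := Y.isClosed_cell
  nonempty_cell := Y.nonempty_cell
  map_mem := Y.map_mem
  full := by
    rw [normalizedLebesgue, Measure.smul_apply]
    exact (congrArg _ Y.full).trans (smul_zero _)
  regular i := (Y.closure_interior_cell i).symm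
  disjoint i j hij := Set.disjoint_iff_inter_eq_empty.1
    ((Y.disjoint_cell hij).mono interior_subset interior_subset)
  markov i _ h := Y.cell_subset_image i (Y.cls_eq_of_nonempty i h)

theorem absDetDeriv_inducedMap {i : ι} {x : M}
    (hx : x ∈ interior (Y.cell i)) :
    absDetDeriv d Y.inducedMap x = scal d (Y.map i) x ^ d := by
  have h : Y.inducedMap =ᶠ[𝓝 x] Y.map i := by
    filter_upwards [isOpen_interior.mem_nhds hx] with y hy using Y.inducedMap_eq hy
  rw [absDetDeriv_congr h, (Y.conformal i).absDetDeriv_eq]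

theorem continuous_iterate (a : ℕ → ι) (k : ℕ) :
    Continuous (Y.markovPartition.iterate a k) := by
  induction k with
  | zero => exact continuous_id
  | succ k ih => exact (Y.conformal (a k)).continuous.comp ih

/-- Existence is compactness along the itinerary; uniqueness holds because two points with the same
itinerary are within `σ ^ k * 2ρ` for every `k`. -/
theorem generating [IsRiemannianManifold (𝓡 d) M] : Y.markovPartition.Generating := by
  intro a ha
  set P := Y.markovPartition with hP
  have hcl : ∀ k, IsClosed (P.iterate a k ⁻¹' P.cell (a k)) := fun k =>
    (Y.isClosed_cell _).preimage (Y.continuous_iterate a k)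
  -- Every point of the `k`-th cell is pulled back through the Markov covering relations, so each
  -- finite itinerary is realized.
  have hex : ∀ k, ∀ y ∈ P.cell (a k), ∃ x, P.iterate a k x = y ∧
      ∀ j ≤ k, P.iterate a j x ∈ P.cell (a j) := by
    intro k
    induction k with
    | zero =>
      intro y hy
      refine ⟨y, rfl, fun j hj => ?_⟩
      obtain rfl : j = 0 := by omega
      exact hy
    | succ k ih =>
      intro y hy
      obtain ⟨z, hz, rfl⟩ := P.markov _ _ (ha k) hy
      obtain ⟨x, rfl, hx⟩ := ih z hz
      refine ⟨x, rfl, fun j hj => ?_⟩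
      rcases Nat.le_succ_iff.1 hj with h | rfl
      · exact hx j h
      · exact hy
  have hne : (⋂ k, ⋂ j ≤ k, P.iterate a j ⁻¹' P.cell (a j)).Nonempty := by
    refine IsCompact.nonempty_iInter_of_sequence_nonempty_isCompact_isClosed _ ?_ ?_ ?_ ?_
    · intro k
      exact biInter_mono (fun j hj => le_trans hj k.le_succ) fun _ _ => subset_rfl
    · intro k
      obtain ⟨y, hy⟩ := P.nonempty_cell (a k)
      obtain ⟨x, -, hx⟩ := hex k y hy
      exact ⟨x, mem_iInter₂.2 hx⟩
    · exact (isClosed_biInter fun j _ => hcl j).isCompact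
    · exact fun k => isClosed_biInter fun j _ => hcl j
  obtain ⟨x, hx⟩ := hne
  have hx' : ∀ k, P.iterate a k x ∈ P.cell (a k) := fun k =>
    mem_iInter₂.1 (mem_iInter.1 hx k) k le_rfl
  refine ⟨x, Subset.antisymm (fun y hy => ?_) (singleton_subset_iff.2 (mem_iInter.2 hx'))⟩
  have hy' : ∀ k, P.iterate a k y ∈ P.cell (a k) := fun k => mem_iInter.1 hy k
  have hσ := Y.σ_pos
  have hstep : ∀ k, dist y x ≤ Y.σ ^ k * dist (P.iterate a k y) (P.iterate a k x) := by
    intro k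
    induction k with
    | zero => simp [MarkovPartition.iterate]
    | succ k ih =>
      refine ih.trans ?_
      rw [pow_succ, mul_assoc]
      gcongr
      exact Y.dist_le_of_mem_cell _ (hy' k) (hx' k)
  have hbound : ∀ k, dist y x ≤ Y.σ ^ k * (2 * Y.ρ) := by
    intro k
    refine (hstep k).trans ?_
    gcongr
    have h1 := mem_closedBall.1 (Y.B_subset _ (Y.cell_subset_B _ (hy' k)))
    have h2 := mem_closedBall.1 (Y.B_subset _ (Y.cell_subset_B _ (hx' k)))
    linarith [dist_triangle_right (P.iterate a k y) (P.iterate a k x) (Y.center (Y.cls (a k)))]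
  have hlim : Filter.Tendsto (fun k => Y.σ ^ k * (2 * Y.ρ)) Filter.atTop (𝓝 (0 * (2 * Y.ρ))) :=
    (tendsto_pow_atTop_nhds_zero_of_lt_one hσ.le Y.σ_lt_one).mul_const _
  rw [zero_mul] at hlim
  exact dist_le_zero.1 (ge_of_tendsto' hlim hbound)

theorem dense_domain [(Measure.euclideanHausdorffMeasure d : Measure M).IsOpenPosMeasure] :
    Dense Y.markovPartition.domain := by
  have h1 : Dense (⋃ i, Y.cell i) :=
    Measure.dense_of_ae (μ := Measure.euclideanHausdorffMeasure d) Y.full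
  refine dense_closure.1 (h1.mono (iUnion_subset fun i => ?_))
  rw [← Y.closure_interior_cell i]
  exact closure_mono (subset_iUnion (fun i => interior (Y.cell i)) i)

theorem exists_hasWordLength (i : ι) :
    ∃ k, 0 < k ∧ HasWordLength g (Y.map i) k := by
  obtain ⟨w, hw⟩ := Y.map_mem i
  refine ⟨w.length, List.length_pos_iff.2 ?_, w, rfl, hw.symm⟩
  -- The empty word is the identity, whose conformal factor `1` is not greater than `σ⁻¹`.
  rintro rfl
  obtain ⟨x, hx⟩ := Y.nonempty_cell i
  have h1 := Y.expanding i x hx.1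
  rw [← hw] at h1
  have h2 : scal d (wordMap g []) x = 1 := scal_id x
  rw [h2] at h1
  exact absurd h1 (not_lt.2 ((one_le_inv₀ Y.σ_pos).2 Y.σ_lt_one.le))

theorem finiteImages [(Measure.euclideanHausdorffMeasure d : Measure M).IsOpenPosMeasure] :
    Y.markovPartition.FiniteImages Y.n := by
  refine ⟨Y.B, fun c c' h => ?_, Y.isOpen_B, ?_⟩
  · obtain ⟨x, hx⟩ := Y.nonempty_B c
    exact Y.cls_eq_of_mem hx (h ▸ hx)
  · apply Subset.antisymm
    · rintro _ ⟨i, rfl⟩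
      exact ⟨Y.cls i, (Y.image_interior_cell i).symm⟩
    · rintro _ ⟨c, rfl⟩
      obtain ⟨i, rfl⟩ := Y.exists_cls_eq c
      exact ⟨i, Y.image_interior_cell i⟩

/-- One branch is chosen per class; for a cell of class `c`, the branch chosen for `c` serves in
both inclusions. -/
theorem finiteCycle [(Measure.euclideanHausdorffMeasure d : Measure M).IsOpenPosMeasure] :
    Y.markovPartition.FiniteCycle Y.n := by
  choose b hb using Y.exists_cls_eq
  exact ⟨b, fun l => ⟨Y.cls l, Y.cls l, Y.cell_subset_image _ (hb _),
    Y.cell_subset_image _ (hb _).symm⟩⟩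

theorem distortion_inducedMap {i : ι} {x y : M}
    (hx : x ∈ interior (Y.cell i)) (hy : y ∈ interior (Y.cell i)) :
    absDetDeriv d Y.inducedMap x / absDetDeriv d Y.inducedMap y ≤ Y.K ^ d := by
  have hh := Y.conformal i
  rw [Y.absDetDeriv_inducedMap hx, Y.absDetDeriv_inducedMap hy, ← div_pow]
  have h1 := Y.distortion i x (interior_subset hx).1 y (interior_subset hy).1
  have h2 := hh.scal_pos x
  have h3 := hh.scal_pos y
  gcongr
  rwa [div_le_iff₀ h3]

theorem isInducingScheme [IsRiemannianManifold (𝓡 d) M]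
    [(Measure.euclideanHausdorffMeasure d : Measure M).IsOpenPosMeasure] :
    ∃ τ : ι → ℕ, IsInducingScheme Y.markovPartition τ Y.inducedMap := by
  choose τ hτ hτ' using Y.exists_hasWordLength
  refine ⟨τ, ⟨⟨isOpen_iUnion fun i => isOpen_interior, Y.dense_domain⟩,
    fun i => ⟨hτ i, hτ' i⟩, fun i x hx => Y.inducedMap_eq hx,
    ⟨Y.n, Y.finiteImages, Y.finiteCycle⟩,
    fun i => ⟨Y.dom i, Y.isOpen_dom i, Y.isConnected_dom i, Y.cell_subset_dom i,
      isDiffeoOntoImage_of_injOn (Y.conformal i).diffeo (Y.isOpen_dom i)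
        (Y.injOn i)⟩,
    Y.generating, ⟨Y.σ, Y.σ_pos, Y.σ_lt_one, fun i x hx => ?_⟩,
    ⟨Y.K ^ d, pow_pos Y.K_pos d, fun i x hx y hy => ⟨?_, Y.distortion_inducedMap hx hy⟩⟩⟩⟩
  · change invDerivNorm d (Y.map i) x < Y.σ
    rw [(Y.conformal i).invDerivNorm_eq]
    exact inv_lt_of_inv_lt₀ Y.σ_pos (Y.expanding i x hx.1)
  · have h1 := Y.distortion_inducedMap hy hx
    have h2 : 0 < absDetDeriv d Y.inducedMap y / absDetDeriv d Y.inducedMap x := by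
      rw [Y.absDetDeriv_inducedMap hx, Y.absDetDeriv_inducedMap hy]
      have := (Y.conformal i).scal_pos
      exact div_pos (pow_pos (this y) d) (pow_pos (this x) d)
    rw [← inv_div]
    exact inv_anti₀ h2 h1

end ReturnSystem

end InducingScheme

/-- In dimension zero every operator norm vanishes and `0⁻¹ = 0`, so no map expands. Positive
dimension makes conformal factors positive. -/
theorem IsLocallyExpanding.dim_ne_zero {d : ℕ} {M : Type*} [MetricSpace M] [Nonempty M]
    [ChartedSpace (EuclideanSpace ℝ (Fin d)) M]
    [IsManifold (𝓡 d) ∞ M] [RiemannianBundle (fun x : M => TangentSpace (𝓡 d) x)]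
    {N : ℕ} {g : Fin N → M → M} (h : IsLocallyExpanding d g) : d ≠ 0 := by
  rintro rfl
  obtain ⟨f, -, hf⟩ := h (Classical.arbitrary M)
  have hs : ∀ x : M, Subsingleton (TangentSpace (𝓡 0) x) := fun x =>
    inferInstanceAs (Subsingleton (EuclideanSpace ℝ (Fin 0)))
  have h0 : invDerivNorm 0 f (Classical.arbitrary M) = 0 := by
    rw [invDerivNorm, ContinuousLinearMap.opNorm_subsingleton]
  rw [h0, inv_zero] at hf
  linarith

theorem theoremB {d : ℕ} {M : Type*} [MetricSpace M] [CompactSpace M] [ConnectedSpace M]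
    [MeasurableSpace M] [BorelSpace M]
    [ChartedSpace (EuclideanSpace ℝ (Fin d)) M] [IsManifold (𝓡 d) ∞ M]
    [RiemannianBundle (fun x : M => TangentSpace (𝓡 d) x)]
    [IsContMDiffRiemannianBundle (𝓡 d) ∞ (EuclideanSpace ℝ (Fin d))
      (fun x : M => TangentSpace (𝓡 d) x)]
    [IsRiemannianManifold (𝓡 d) M]
    {N : ℕ} (g : Fin N → M → M) (α : ℝ≥0) (hα : 0 < α) (hα' : α ≤ 1)
    (hg_diffeo : ∀ i, IsLocalDiffeomorph (𝓡 d) (𝓡 d) 1 (g i))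
    (hg_holder : ∀ i, IsC1Holder d α (g i))
    (hg_conformal : ∀ i, IsConformalOn d (g i))
    (h_exp : IsLocallyExpanding d g)
    (h_mix : IsTopologicallyMixing d g) :
    ∃ (ι : Type) (_ : Countable ι) (P : MarkovPartition d g ι) (τ : ι → ℕ) (T : M → M),
      IsInducingScheme P τ T := by
  have hne : NeZero d := ⟨h_exp.dim_ne_zero⟩
  have hg : ∀ i, IsConformalLocalDiffeo d (g i) := fun i => ⟨hg_diffeo i, hg_conformal i⟩
  have hlog : ∀ h ∈ generatedSemigroup g, ∀ x,
      LocHolderAt α (fun y => Real.log (scal d h y)) x := fun h hh x =>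
    locHolderAt_log_scal_of_mem hα hg
      (fun i => locHolderAt_log_scal hα hα' (hg i) (hg_holder i)) hh x
  obtain ⟨D, hD⟩ := h_mix
  obtain ⟨ι, hι, ⟨Y⟩⟩ := D.exists_returnSystem hα hg hlog hD
  have := isOpenPosMeasure_euclideanHausdorffMeasure d M
  obtain ⟨τ, hτ⟩ := Y.isInducingScheme
  exact ⟨ι, hι, Y.markovPartition, τ, Y.inducedMap, hτ⟩
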